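/- Let $U\subset\mathbb R^2$ be an open set containing $0$, let $f:U\to\mathbb R$ be real analytic, and let $x:[0,\beta)\to U$, $0<\beta\le\infty$, be a trajectory of the gradient of $f$, i.e. $x'(t)=\nabla f(x(t))$ for all $t\in[0,\beta)$ (Euclidean gradient, one-sided derivative at $t=0$), such that $x(t)\to 0$ as $t\to\beta$. Let $V\subset\mathbb R^2$ be an open neighbourhood of $0$ and let $\Gamma$ be an analytic subset of $V$, i.e. $\Gamma\subset V$ and every point of $V$ has an open neighbourhood $W\subset V$ in which $\Gamma\cap W$ is the set of common zeros of finitely many real analytic functions on $W$. Let $t_0\in[0,\beta)$ be such that $x(t)\in V$ for all $t\in[t_0,\beta)$ (such a $t_0$ exists since $x(t)\to0$; if the whole trajectory lies in $V$, one may take $t_0=0$). Then either $x(t)\in\Gamma$ for all $t\in[t_0,\beta)$, or the set $\{t\in[t_0,\beta): x(t)\in\Gamma\}$ is finite; in particular, in the second case this part of the trajectory meets $\Gamma$ in finitely many points. -/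

import Mathlib

open Filter Topology

/-- The half-open time interval `[0, β)`, where `β` may be `+∞`. -/
def timeInterval (β : EReal) : Set ℝ := {t : ℝ | 0 ≤ t ∧ (t : EReal) < β}

/-- `x : [0, β) → U` is a trajectory of the gradient `∇ f` of `f : U → ℝ`:
`x' (t) = ∇ f (x t)` for all `t ∈ [0, β)`, with the one-sided derivative at `t = 0`.
Only the values of `f` on `U` and of `x` on `[0, β)` matter (for `U` open). Maximality of the
curve is not demanded, so all maximal trajectories are covered, and also their restrictions. -/
structure IsGradientTrajectory {E : Type*} [NormedAddCommGroup E] [InnerProductSpace ℝ E]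
    [CompleteSpace E] (U : Set E) (f : E → ℝ) (β : EReal) (x : ℝ → E) : Prop where
  pos : 0 < β
  mem : ∀ t ∈ timeInterval β, x t ∈ U
  deriv : ∀ t ∈ timeInterval β, HasDerivWithinAt x (gradient f (x t)) (timeInterval β) t

/-- `Γ` is a (real) analytic subset of the open set `V`: near every point of `V` (not only of `Γ`,
so that `Γ` is relatively closed in `V`) it is the set of common zeros of finitely many real
analytic functions. -/
def IsAnalyticSubset {E : Type*} [NormedAddCommGroup E] [NormedSpace ℝ E] (V Γ : Set E) : Prop :=
  Γ ⊆ V ∧ ∀ p ∈ V, ∃ W : Set E, IsOpen W ∧ p ∈ W ∧ W ⊆ V ∧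
    ∃ (k : ℕ) (g : Fin k → E → ℝ), (∀ i, AnalyticOnNhd ℝ (g i) W) ∧
      ∀ y ∈ W, y ∈ Γ ↔ ∀ i, g i y = 0

-- The trajectory is an analytic curve, because solutions of analytic differential equations are
-- analytic (`analyticAt_of_eventually_hasDerivAt`). Hence around every time it either lies in `Γ`
-- or meets `Γ` at most at that time, and connectedness of the time interval makes one alternative
-- hold throughout. In the second case infinitely many meeting times could only accumulate at `β`,
-- so everything reduces to excluding oscillation at the end.
--
-- If `β` is finite, the curve extends analytically through `β` (`exists_analyticAt_extension`) and
-- the same local dichotomy applies there. If `β = ∞`, a curve that does not come to rest at the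
-- origin is written in polar coordinates. With `F` the function `f` in these coordinates, `r' = ∂_r
-- F` and `θ' = ∂_θ F / r²`.
--
-- The angle converges (`exists_tendsto_angle`). Unless `θ` is eventually constant, `F - F(r, 0) = r
-- ^ k G` with `κ = G(0, ·)` periodic and nonconstant. Near `r = 0` the ray of angle `c` can be
-- crossed only in the direction given by the sign of `κ' c`. Both signs occur, which prevents
-- spiralling, and `κ' ≠ 0` on a dense set, which prevents oscillation.
--
-- An analytic `g` in polar coordinates either vanishes near the limit point or is a power of `r`
-- times some `G`. By a Newton–Puiseux argument (`exists_puiseuxCovered`) the zeros of `G` with `r >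
-- 0` near the limit point lie on finitely many arcs `θ = φ (r ^ (1/N))`. The speed of `θ - φ (r ^
-- (1/N))` on such an arc has the sign of an analytic function of `r ^ (1/N)`. Either this vanishes
-- identically and the arc is invariant, or its sign is constant near `0` and late crossings all
-- have one direction, so there is at most one (`eventually_eq_or_eventually_ne_arc`).

attribute [local fun_prop] analyticAt_fst analyticAt_snd

/-! ### Analyticity of superposition operators on spaces of continuous maps. -/

section Nemytskii

variable {K E F : Type*} [TopologicalSpace K] [CompactSpace K]
  [NormedAddCommGroup E] [NormedSpace ℝ E] [NormedAddCommGroup F] [NormedSpace ℝ F]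

/-- The multilinear map on `C(K, E)` obtained by applying a continuous multilinear map pointwise. -/
noncomputable def ContinuousMultilinearMap.pointwise (K : Type*) [TopologicalSpace K]
    [CompactSpace K] {n : ℕ} (p : ContinuousMultilinearMap ℝ (fun _ : Fin n => E) F) :
    ContinuousMultilinearMap ℝ (fun _ : Fin n => C(K, E)) C(K, F) :=
  MultilinearMap.mkContinuous
    { toFun := fun y => ⟨fun t => p fun i => y i t, by fun_prop⟩
      map_update_add' := by
        intro _ m i x y
        ext t
        have h : ∀ z : C(K, E), (fun j => (Function.update m i z j) t)
            = Function.update (fun j => m j t) i (z t) := by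
          intro z; ext j
          by_cases hj : j = i
          · subst hj; simp
          · simp [hj]
        simp only [ContinuousMap.coe_mk, ContinuousMap.add_apply, h, p.map_update_add]
      map_update_smul' := by
        intro _ m i c x
        ext t
        have h : ∀ z : C(K, E), (fun j => (Function.update m i z j) t)
            = Function.update (fun j => m j t) i (z t) := by
          intro z; ext j
          by_cases hj : j = i
          · subst hj; simp
          · simp [hj]
        simp only [ContinuousMap.coe_mk, ContinuousMap.smul_apply, h, p.map_update_smul] }
    ‖p‖ (by
      intro m
      rw [ContinuousMap.norm_le _ (by positivity)]
      intro t
      refine (p.le_opNorm _).trans ?_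
      gcongr with i
      exact (m i).norm_coe_le_norm t)

theorem ContinuousMultilinearMap.norm_pointwise_le {n : ℕ}
    (p : ContinuousMultilinearMap ℝ (fun _ : Fin n => E) F) : ‖p.pointwise K‖ ≤ ‖p‖ :=
  MultilinearMap.mkContinuous_norm_le _ (norm_nonneg _) _

/-- Composition with an analytic map is an analytic operator between spaces of continuous maps. -/
theorem AnalyticAt.exists_analyticAt_comp_continuousMap [CompleteSpace F] (K : Type*)
    [TopologicalSpace K] [CompactSpace K] {X : E → F} {p : E} (hX : AnalyticAt ℝ X p) :
    ∃ N : C(K, E) → C(K, F), AnalyticAt ℝ N (ContinuousMap.const K p) ∧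
      ∀ᶠ y in 𝓝 (ContinuousMap.const K p), ∀ t, N y t = X (y t) := by
  obtain ⟨P, r, hP⟩ := hX
  -- The coefficients of `P` act pointwise without increase of norm, so the radius does not shrink.
  -- Evaluation at `t` is continuous linear and carries the sum of `Q` to that of `P`.
  let Q : FormalMultilinearSeries ℝ C(K, E) C(K, F) := fun n => (P n).pointwise K
  have hrad : P.radius ≤ Q.radius :=
    FormalMultilinearSeries.radius_le_of_le fun n => (P n).norm_pointwise_le
  have hr : r ≤ Q.radius := hP.r_le.trans hrad
  have hQ : HasFPowerSeriesOnBall Q.sum Q 0 Q.radius :=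
    Q.hasFPowerSeriesOnBall (hP.r_pos.trans_le hr)
  refine ⟨fun y => Q.sum (y - ContinuousMap.const K p), ?_, ?_⟩
  · have h0 : AnalyticAt ℝ Q.sum (ContinuousMap.const K p - ContinuousMap.const K p) := by
      rw [sub_self]; exact hQ.analyticAt
    exact AnalyticAt.fun_comp h0 (by fun_prop)
  · filter_upwards [Metric.eball_mem_nhds (ContinuousMap.const K p) hP.r_pos] with y hy t
    have hy' : y - ContinuousMap.const K p ∈ Metric.eball (0 : C(K, E)) Q.radius := by
      rw [Metric.mem_eball, edist_zero_right]
      rw [Metric.mem_eball, edist_eq_enorm_sub] at hy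
      exact hy.trans_le hr
    have h1 := hQ.hasSum hy'
    rw [zero_add] at h1
    have h2 := h1.map (ContinuousMap.evalCLM (M := F) ℝ t) (ContinuousMap.evalCLM ℝ t).continuous
    have hyt : y t - p ∈ Metric.eball (0 : E) r := by
      rw [Metric.mem_eball, edist_zero_right]
      rw [Metric.mem_eball, edist_eq_enorm_sub] at hy
      refine lt_of_le_of_lt ?_ hy
      rw [enorm_le_iff_norm_le]
      exact (y - ContinuousMap.const K p).norm_coe_le_norm t
    have h3 := hP.hasSum hyt
    rw [add_sub_cancel] at h3
    exact h2.unique h3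

end Nemytskii

/-! ### Analyticity of solutions of analytic differential equations. -/

section AnalyticODE

variable {E : Type*} [NormedAddCommGroup E] [NormedSpace ℝ E]

/-- The Volterra operator `y ↦ (s ↦ ∫ τ in 0..s, y τ)` on `C([0, 1], E)`. -/
noncomputable def volterra (E : Type*) [NormedAddCommGroup E] [NormedSpace ℝ E] :
    C(Set.Icc (0 : ℝ) 1, E) →L[ℝ] C(Set.Icc (0 : ℝ) 1, E) :=
  LinearMap.mkContinuous
    { toFun := fun y => ⟨fun s => ∫ τ in (0 : ℝ)..s, Set.IccExtend zero_le_one y τ, by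
        have h : Continuous (Set.IccExtend (zero_le_one' ℝ) y) := y.continuous.Icc_extend'
        exact (intervalIntegral.continuous_primitive
          (fun a b => h.intervalIntegrable a b) 0).comp continuous_subtype_val⟩
      map_add' := by
        intro y z
        have hy : Continuous (Set.IccExtend (zero_le_one' ℝ) y) := y.continuous.Icc_extend'
        have hz : Continuous (Set.IccExtend (zero_le_one' ℝ) z) := z.continuous.Icc_extend'
        ext s
        simp only [ContinuousMap.coe_mk, ContinuousMap.add_apply]
        rw [← intervalIntegral.integral_add (hy.intervalIntegrable _ _)
          (hz.intervalIntegrable _ _)]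
        rfl
      map_smul' := by
        intro c y
        ext s
        simp only [ContinuousMap.coe_mk, ContinuousMap.smul_apply, RingHom.id_apply]
        rw [← intervalIntegral.integral_smul]
        rfl }
    1 (by
      intro y
      rw [ContinuousMap.norm_le _ (by positivity)]
      intro s
      have h := intervalIntegral.norm_integral_le_of_norm_le_const
        (f := Set.IccExtend zero_le_one y) (C := ‖y‖) (a := 0) (b := s)
        (fun τ _ => y.norm_coe_le_norm _)
      refine h.trans ?_
      have hs : |(s : ℝ) - 0| ≤ 1 := by
        rw [sub_zero, abs_of_nonneg s.2.1]; exact s.2.2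
      nlinarith [norm_nonneg y])

/-- Solutions of an autonomous analytic differential equation are analytic. -/
theorem analyticAt_of_eventually_hasDerivAt [CompleteSpace E] {X : E → E} {α : ℝ → E} {t₀ : ℝ}
    (hX : AnalyticAt ℝ X (α t₀)) (hα : ∀ᶠ t in 𝓝 t₀, HasDerivAt α (X (α t)) t) :
    AnalyticAt ℝ α t₀ := by
  set I := Set.Icc (0 : ℝ) 1
  set p := ContinuousMap.const I (α t₀) with hp
  obtain ⟨N, hN, hNX⟩ := hX.exists_analyticAt_comp_continuousMap I
  -- `Ψ (l, y) = 0` is the integral equation `y s = α t₀ + l ∫₀ˢ X (y τ) dτ`, solved by the rescaled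
  -- curve `s ↦ α (t₀ + l s)`. Its partial derivative in `y` at `l = 0` is the identity, so the
  -- solution depends analytically on `l`. The value at `s = 1` is `α (t₀ + l)`.
  let Ψ : ℝ × C(I, E) → C(I, E) := fun v => v.2 - p - v.1 • volterra E (N v.2)
  have hΨ : AnalyticAt ℝ Ψ (0, p) := by
    have h1 : AnalyticAt ℝ (fun v : ℝ × C(I, E) => N v.2) (0, p) :=
      AnalyticAt.fun_comp (g := N) (f := Prod.snd) (x := ((0 : ℝ), p)) hN analyticAt_snd
    have h2 : AnalyticAt ℝ (fun v : ℝ × C(I, E) => volterra E (N v.2)) (0, p) :=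
      ((volterra E).analyticAt _).fun_comp h1
    exact (analyticAt_snd.sub analyticAt_const).sub (analyticAt_fst.smul h2)
  have hΨ0 : Ψ (0, p) = 0 := by simp [Ψ]
  -- In `WithTop ℕ∞` the top element is the analytic class, not merely `C^∞`.
  have cdf : ContDiffAt ℝ ⊤ Ψ (0, p) := hΨ.contDiffAt
  have hder : fderiv ℝ Ψ (0, p) ∘L .inr ℝ ℝ C(I, E) = .id ℝ _ := by
    have h1 : HasFDerivAt (fun y : C(I, E) => Ψ (0, y))
        (fderiv ℝ Ψ (0, p) ∘L .inr ℝ ℝ C(I, E)) p :=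
      HasFDerivAt.comp p (f := fun y : C(I, E) => ((0 : ℝ), y))
        hΨ.differentiableAt.hasFDerivAt (hasFDerivAt_prodMk_right 0 p)
    have h2 : HasFDerivAt (fun y : C(I, E) => Ψ (0, y)) (.id ℝ _) p := by
      have : (fun y : C(I, E) => Ψ (0, y)) = fun y => y - p := by ext y; simp [Ψ]
      rw [this]
      exact (hasFDerivAt_id p).sub_const p
    exact h1.unique h2
  have inv : (fderiv ℝ Ψ (0, p) ∘L .inr ℝ ℝ C(I, E)).IsInvertible := by
    rw [hder]; exact ⟨.refl ℝ _, rfl⟩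
  have hne : (⊤ : WithTop ℕ∞) ≠ 0 := by simp
  let φ := cdf.implicitFunction hne inv
  have hφ : AnalyticAt ℝ φ 0 :=
    (cdf.contDiffAt_implicitFunction hne inv).analyticAt
  have hiff := cdf.eventually_apply_eq_iff_implicitFunction hne inv
  rw [hΨ0] at hiff
  obtain ⟨A, hA, B, hB, hAB⟩ := mem_nhds_prod_iff.1 (hiff.and
    ((continuous_snd (X := ℝ) (Y := C(I, E))).tendsto (0, p) |>.eventually hNX))
  obtain ⟨ε, hε, hεB⟩ := Metric.mem_nhds_iff.1 hB
  have hcont : ContinuousAt α t₀ := hα.self_of_nhds.continuousAt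
  obtain ⟨δ, hδ, hδα⟩ := Metric.eventually_nhds_iff_ball.1
    (hα.and (hcont.eventually (Metric.ball_mem_nhds _ (half_pos hε))))
  have key : ∀ᶠ l in 𝓝 (0 : ℝ), φ l ⟨1, by simp [I]⟩ = α (t₀ + l) := by
    filter_upwards [hA, Metric.ball_mem_nhds (0 : ℝ) hδ] with l hlA hlδ
    have hmem : ∀ s ∈ I, t₀ + l * s ∈ Metric.ball t₀ δ := by
      intro s hs
      rw [Metric.mem_ball, Real.dist_eq, add_sub_cancel_left, abs_mul, abs_of_nonneg hs.1]
      rw [Metric.mem_ball, Real.dist_eq, sub_zero] at hlδ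
      nlinarith [hs.2, abs_nonneg l]
    have hcs : ContinuousOn (fun s : ℝ => α (t₀ + l * s)) I := by
      intro s hs
      refine ContinuousAt.continuousWithinAt ?_
      exact ContinuousAt.comp (g := α) (hδα _ (hmem s hs)).1.continuousAt (by fun_prop)
    let y : C(I, E) := ⟨fun s => α (t₀ + l * s), continuousOn_iff_continuous_domRestrict.1 hcs⟩
    have hyB : y ∈ B := by
      apply hεB
      rw [Metric.mem_ball]
      refine lt_of_le_of_lt ((ContinuousMap.dist_le (half_pos hε).le).2 ?_) (half_lt_self hε)
      intro s
      exact (hδα _ (hmem s s.2)).2.le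
    obtain ⟨h1, h2⟩ := hAB (show ((l, y) : ℝ × C(I, E)) ∈ A ×ˢ B from ⟨hlA, hyB⟩)
    have hsol : Ψ (l, y) = 0 := by
      ext s
      have hsI : Set.uIcc (0 : ℝ) s ⊆ I := by
        rw [Set.uIcc_of_le s.2.1]; exact Set.Icc_subset_Icc_right s.2.2
      have hd : ∀ τ ∈ Set.uIcc (0 : ℝ) s, HasDerivAt (fun τ => α (t₀ + l * τ))
          (l • Set.IccExtend zero_le_one (N y) τ) τ := by
        intro τ hτ
        have e : Set.IccExtend (zero_le_one' ℝ) (N y) τ = X (α (t₀ + l * τ)) := by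
          rw [Set.IccExtend_of_mem _ _ (hsI hτ), h2]; rfl
        have hlin : HasDerivAt (fun τ : ℝ => t₀ + l * τ) l τ := by
          simpa using ((hasDerivAt_id τ).const_mul l).const_add t₀
        rw [e]
        exact (hδα _ (hmem τ (hsI hτ))).1.scomp τ hlin
      have hc : Continuous (Set.IccExtend (zero_le_one' ℝ) (N y)) := (N y).continuous.Icc_extend'
      have hint := intervalIntegral.integral_eq_sub_of_hasDerivAt hd
        ((hc.const_smul l).intervalIntegrable _ _)
      have e2 : Ψ (l, y) s = α (t₀ + l * s) - α t₀
          - l • ∫ τ in (0 : ℝ)..s, Set.IccExtend zero_le_one (N y) τ := rfl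
      rw [e2, ← intervalIntegral.integral_smul, hint]
      simp
    have := (h1.1 hsol)
    change φ l = y at this
    rw [this]
    change α (t₀ + l * 1) = _
    rw [mul_one]
  have h1 : AnalyticAt ℝ (fun l => α (t₀ + l)) 0 :=
    AnalyticAt.congr (((ContinuousMap.evalCLM (M := E) ℝ (⟨1, by simp [I]⟩ : I)).analyticAt
      _).fun_comp hφ) key
  have h2 : AnalyticAt ℝ (fun t => α (t₀ + (t - t₀))) t₀ := by
    have h3 : AnalyticAt ℝ (fun l => α (t₀ + l)) (t₀ - t₀) := by rwa [sub_self]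
    exact AnalyticAt.fun_comp (g := fun l => α (t₀ + l)) (f := fun t => t - t₀) h3 (by fun_prop)
  simpa using h2

end AnalyticODE

/-! ### Divided differences of analytic functions. -/

section Division

/-- The segment `t ↦ (t u, w)` as a continuous map, depending linearly on `(u, w)`. -/
noncomputable def segmentMap : ℝ × ℝ →L[ℝ] C(Set.Icc (0 : ℝ) 1, ℝ × ℝ) :=
  LinearMap.toContinuousLinearMap
    { toFun := fun q => ⟨fun t => (t * q.1, q.2), by fun_prop⟩
      map_add' := by intro x y; ext t <;> simp [mul_add]
      map_smul' := by intro c x; ext t <;> simp [mul_left_comm] }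

theorem AnalyticAt.hasDerivAt_fst {F : ℝ × ℝ → ℝ} {q : ℝ × ℝ} (hF : AnalyticAt ℝ F q) :
    HasDerivAt (fun r => F (r, q.2)) (fderiv ℝ F q (1, 0)) q.1 := by
  have h : HasDerivAt (fun r : ℝ => (r, q.2)) ((1 : ℝ), (0 : ℝ)) q.1 :=
    (hasDerivAt_id q.1).prodMk (hasDerivAt_const q.1 q.2)
  exact HasFDerivAt.comp_hasDerivAt (l := F) (f := fun r : ℝ => (r, q.2)) q.1
    hF.differentiableAt.hasFDerivAt h

theorem AnalyticAt.hasDerivAt_snd {F : ℝ × ℝ → ℝ} {q : ℝ × ℝ} (hF : AnalyticAt ℝ F q) :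
    HasDerivAt (fun w => F (q.1, w)) (fderiv ℝ F q (0, 1)) q.2 := by
  have h : HasDerivAt (fun w : ℝ => (q.1, w)) ((0 : ℝ), (1 : ℝ)) q.2 :=
    (hasDerivAt_const q.2 q.1).prodMk (hasDerivAt_id q.2)
  exact HasFDerivAt.comp_hasDerivAt (l := F) (f := fun w : ℝ => (q.1, w)) q.2
    hF.differentiableAt.hasFDerivAt h

theorem AnalyticAt.fderiv_apply_const {E F : Type*} [NormedAddCommGroup E] [NormedSpace ℝ E]
    [NormedAddCommGroup F] [NormedSpace ℝ F] [CompleteSpace F] {f : E → F} {x : E}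
    (hf : AnalyticAt ℝ f x) (v : E) : AnalyticAt ℝ (fun y => fderiv ℝ f y v) x :=
  ((ContinuousLinearMap.apply ℝ F v).analyticAt _).fun_comp hf.fderiv

/-- The divided difference in the first variable of an analytic function is analytic. -/
theorem AnalyticAt.dslope_fst {F : ℝ × ℝ → ℝ} {c : ℝ} (hF : AnalyticAt ℝ F (0, c)) :
    AnalyticAt ℝ (fun q : ℝ × ℝ => dslope (fun r => F (r, q.2)) 0 q.1) (0, c) := by
  set I := Set.Icc (0 : ℝ) 1
  have hX : AnalyticAt ℝ (fun q => fderiv ℝ F q (1, 0)) (0, c) := hF.fderiv_apply_const _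
  obtain ⟨N, hN, hNX⟩ := hX.exists_analyticAt_comp_continuousMap I
  have hA0 : segmentMap (0, c) = ContinuousMap.const I (0, c) := by
    refine ContinuousMap.ext fun t => ?_
    change ((t : ℝ) * 0, c) = (0, c)
    rw [mul_zero]
  -- Hadamard's formula: the divided difference at `(r, w)` is `∫₀¹ ∂₁F (τ r, w) dτ`, a
  -- superposition operator between continuous linear maps.
  have h1 : AnalyticAt ℝ (fun q : ℝ × ℝ => ContinuousMap.evalCLM (M := ℝ) ℝ
      (⟨1, by simp [I]⟩ : I) (volterra ℝ (N (segmentMap q)))) (0, c) := by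
    refine (ContinuousLinearMap.analyticAt _ _).fun_comp
      ((ContinuousLinearMap.analyticAt _ _).fun_comp ?_)
    refine AnalyticAt.fun_comp (g := N) ?_ (segmentMap.analyticAt _)
    rwa [hA0]
  refine h1.congr ?_
  have hev : ∀ᶠ q in 𝓝 ((0 : ℝ), c), ∀ t, N (segmentMap q) t
      = fderiv ℝ F (segmentMap q t) (1, 0) := by
    have h := segmentMap.continuous.tendsto (0, c)
    rw [hA0] at h
    exact h.eventually hNX
  obtain ⟨ε, hε, hεF⟩ := Metric.eventually_nhds_iff_ball.1 hF.eventually_analyticAt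
  filter_upwards [hev, Metric.ball_mem_nhds _ hε] with q hq hqε
  have hmem : ∀ t ∈ I, (t * q.1, q.2) ∈ Metric.ball ((0 : ℝ), c) ε := by
    intro t ht
    rw [Metric.mem_ball, Prod.dist_eq, max_lt_iff] at hqε ⊢
    refine ⟨?_, hqε.2⟩
    have := hqε.1
    rw [Real.dist_eq, sub_zero] at this ⊢
    rw [abs_mul, abs_of_nonneg ht.1]
    nlinarith [ht.2, abs_nonneg q.1]
  have e : ∀ t ∈ I, Set.IccExtend (zero_le_one' ℝ) (N (segmentMap q)) t
      = fderiv ℝ F (t * q.1, q.2) (1, 0) := by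
    intro t ht
    rw [Set.IccExtend_of_mem _ _ ht, hq]; rfl
  have hc : Continuous (Set.IccExtend (zero_le_one' ℝ) (N (segmentMap q))) :=
    (N (segmentMap q)).continuous.Icc_extend'
  change (∫ τ in (0 : ℝ)..(1 : ℝ), Set.IccExtend (zero_le_one' ℝ) (N (segmentMap q)) τ) = _
  rcases eq_or_ne q.1 0 with h0 | h0
  · have h2 := (hεF _ (hmem 0 (by simp [I]))).hasDerivAt_fst
    rw [h0, dslope_same]
    simp only [zero_mul] at h2
    rw [h2.deriv]
    have : Set.EqOn (Set.IccExtend (zero_le_one' ℝ) (N (segmentMap q)))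
        (fun _ => fderiv ℝ F (0, q.2) (1, 0)) (Set.uIcc 0 1) := by
      intro t ht
      rw [Set.uIcc_of_le zero_le_one] at ht
      rw [e t ht, h0, mul_zero]
    rw [intervalIntegral.integral_congr this]
    simp
  · rw [dslope_of_ne _ h0, slope_def_field]
    have hd : ∀ τ ∈ Set.uIcc (0 : ℝ) 1, HasDerivAt (fun τ => F (τ * q.1, q.2))
        (q.1 • Set.IccExtend zero_le_one (N (segmentMap q)) τ) τ := by
      intro τ hτ
      rw [Set.uIcc_of_le zero_le_one] at hτ
      rw [e τ hτ]
      have hlin : HasDerivAt (fun τ : ℝ => τ * q.1) q.1 τ := by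
        simpa using (hasDerivAt_id τ).mul_const q.1
      exact ((hεF _ (hmem τ hτ)).hasDerivAt_fst).scomp τ hlin
    have hint := intervalIntegral.integral_eq_sub_of_hasDerivAt hd
      ((hc.const_smul q.1).intervalIntegrable _ _)
    rw [intervalIntegral.integral_smul] at hint
    rw [eq_div_iff (by simpa using h0)]
    simp only [one_mul, zero_mul, smul_eq_mul, sub_zero] at hint ⊢
    rw [← hint]; ring

end Division

/-! ### Extraction of powers of the first variable; Taylor expansion in the second. -/

section Division

/-- No regularity is needed: where `q.1 = 0`, the value of `dslope` is multiplied by zero. -/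
theorem dslope_fst_mul (F : ℝ × ℝ → ℝ) (h : ∀ c, F (0, c) = 0) (q : ℝ × ℝ) :
    F q = q.1 * dslope (fun r => F (r, q.2)) 0 q.1 := by
  have := sub_smul_dslope (fun r => F (r, q.2)) 0 q.1
  simp only [sub_zero, smul_eq_mul, h] at this
  exact this.symm

/-- Each division by the first coordinate lowers the order along the line through `(0, c₀)` in
direction `v` by at least one. A finite order on one such line therefore bounds the number of
divisions. -/
theorem exists_eq_pow_mul_of_analyticOrderAt_le {c₀ : ℝ} {v : ℝ × ℝ} (n : ℕ) :
    ∀ F : ℝ × ℝ → ℝ, (∀ c, AnalyticAt ℝ F (0, c)) →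
      analyticOrderAt (fun t : ℝ => F ((0, c₀) + t • v)) 0 ≤ n →
      ∃ (k : ℕ) (G : ℝ × ℝ → ℝ), (∀ c, AnalyticAt ℝ G (0, c)) ∧
        (∀ q, F q = q.1 ^ k * G q) ∧ ∃ c, G (0, c) ≠ 0 := by
  have line : ∀ F : ℝ × ℝ → ℝ, (∀ c, AnalyticAt ℝ F (0, c)) →
      AnalyticAt ℝ (fun t : ℝ => F ((0, c₀) + t • v)) 0 := by
    intro F hF
    refine AnalyticAt.fun_comp (g := F) (f := fun t : ℝ => ((0 : ℝ), c₀) + t • v) ?_ (by fun_prop)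
    simpa using hF c₀
  induction n with
  | zero =>
    intro F hF hn
    refine ⟨0, F, hF, by simp, c₀, ?_⟩
    have h0 : analyticOrderAt (fun t : ℝ => F ((0, c₀) + t • v)) 0 = 0 := by simpa using hn
    have := (line F hF).analyticOrderAt_eq_zero.1 h0
    simpa using this
  | succ n ih =>
    intro F hF hn
    by_cases h : ∃ c, F (0, c) ≠ 0
    · exact ⟨0, F, hF, by simp, h⟩
    push Not at h
    have hG := fun c => (hF c).dslope_fst
    have hFG := dslope_fst_mul F h
    set G := fun q : ℝ × ℝ => dslope (fun r => F (r, q.2)) 0 q.1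
    have hl : AnalyticAt ℝ (fun t : ℝ => t * v.1) 0 := by fun_prop
    have hmul : analyticOrderAt (fun t : ℝ => F ((0, c₀) + t • v)) 0
        = analyticOrderAt (fun t : ℝ => t * v.1) 0
          + analyticOrderAt (fun t : ℝ => G ((0, c₀) + t • v)) 0 := by
      rw [← analyticOrderAt_mul hl (line G hG)]
      congr 1
      ext t
      rw [hFG]
      simp [G]
    have h1 : 1 ≤ analyticOrderAt (fun t : ℝ => t * v.1) 0 := by
      rw [Order.one_le_iff_ne_zero, hl.analyticOrderAt_ne_zero]
      simp
    have h2 : analyticOrderAt (fun t : ℝ => G ((0, c₀) + t • v)) 0 ≤ n := by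
      rw [hmul] at hn
      have h3 : 1 + analyticOrderAt (fun t : ℝ => G ((0, c₀) + t • v)) 0 ≤ 1 + (n : ℕ∞) := by
        refine (add_le_add_left h1 _).trans (hn.trans ?_)
        push_cast
        rw [add_comm]
      exact (ENat.add_le_add_iff_left (by simp)).1 h3
    obtain ⟨k, H, hH, hGH, hne⟩ := ih G hG h2
    refine ⟨k + 1, H, hH, fun q => ?_, hne⟩
    rw [hFG q]
    change q.1 * G q = _
    rw [hGH]
    ring

/-- An analytic function near the axis `{0} × ℝ` is, unless it vanishes there identically, a power
of the first coordinate times an analytic function which does not vanish on the whole axis. -/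
theorem exists_eq_fst_pow_mul {F : ℝ × ℝ → ℝ} (hF : ∀ c, AnalyticAt ℝ F (0, c)) {c₀ : ℝ}
    (hne : ¬ ∀ᶠ q in 𝓝 (0, c₀), F q = 0) :
    ∃ (k : ℕ) (G : ℝ × ℝ → ℝ), (∀ c, AnalyticAt ℝ G (0, c)) ∧
      (∀ q, F q = q.1 ^ k * G q) ∧ ∃ c, G (0, c) ≠ 0 := by
  obtain ⟨ε, hε, hεF⟩ := Metric.eventually_nhds_iff_ball.1 (hF c₀).eventually_analyticAt
  obtain ⟨q, hq, hqF⟩ : ∃ q ∈ Metric.ball ((0 : ℝ), c₀) ε, F q ≠ 0 := by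
    by_contra! h
    exact hne (Filter.eventually_of_mem (Metric.ball_mem_nhds _ hε) h)
  -- The line is aimed at a point where `F ≠ 0`; the identity theorem on the segment makes the order
  -- at `t = 0` finite.
  set v := q - (0, c₀)
  have hmem : ∀ t ∈ Set.Icc (0 : ℝ) 1, ((0 : ℝ), c₀) + t • v ∈ Metric.ball ((0 : ℝ), c₀) ε := by
    intro t ht
    rw [mem_ball_iff_norm] at hq ⊢
    rw [add_sub_cancel_left, norm_smul, Real.norm_of_nonneg ht.1]
    nlinarith [ht.2, norm_nonneg v]
  have hl : AnalyticOnNhd ℝ (fun t : ℝ => F ((0, c₀) + t • v)) (Set.Icc 0 1) := fun t ht =>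
    AnalyticAt.fun_comp (g := F) (f := fun t : ℝ => ((0 : ℝ), c₀) + t • v)
      (hεF _ (hmem t ht)) (by fun_prop)
  have hfin : analyticOrderAt (fun t : ℝ => F ((0, c₀) + t • v)) 0 ≠ ⊤ := by
    rw [Ne, analyticOrderAt_eq_top]
    intro h
    have := hl.eqOn_zero_of_preconnected_of_eventuallyEq_zero isPreconnected_Icc
      (by simp : (0 : ℝ) ∈ Set.Icc (0 : ℝ) 1) h (by simp : (1 : ℝ) ∈ Set.Icc (0 : ℝ) 1)
    simp only [one_smul, v, add_sub_cancel, Pi.zero_apply] at this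
    exact hqF this
  obtain ⟨n, hn⟩ := ENat.ne_top_iff_exists.1 hfin
  exact exists_eq_pow_mul_of_analyticOrderAt_le n F hF hn.ge

/-- Taylor expansion in the second variable. -/
theorem AnalyticAt.exists_taylor_snd (k : ℕ) {G : ℝ × ℝ → ℝ} (hG : AnalyticAt ℝ G (0, 0)) :
    ∃ (a : ℕ → ℝ → ℝ) (h : ℝ × ℝ → ℝ), (∀ j, AnalyticAt ℝ (a j) 0) ∧ AnalyticAt ℝ h (0, 0) ∧
      ∀ q, G q = ∑ j ∈ Finset.range k, a j q.1 * q.2 ^ j + q.2 ^ k * h q := by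
  induction k with
  | zero => exact ⟨fun _ _ => 0, G, fun _ => analyticAt_const, hG, by simp⟩
  | succ k ih =>
    obtain ⟨a, h, ha, hh, hGh⟩ := ih
    have hb : AnalyticAt ℝ (fun u : ℝ => h (u, 0)) 0 :=
      AnalyticAt.fun_comp (g := h) (f := fun u : ℝ => (u, (0 : ℝ))) hh (by fun_prop)
    -- The variables are exchanged so that the divided difference in the first variable extracts a
    -- factor of the second.
    let F : ℝ × ℝ → ℝ := fun q => h (q.2, q.1) - h (q.2, 0)
    have hF : AnalyticAt ℝ F (0, 0) := by
      refine AnalyticAt.sub ?_ ?_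
      · exact AnalyticAt.fun_comp (g := h) (f := fun q : ℝ × ℝ => (q.2, q.1)) hh (by fun_prop)
      · exact AnalyticAt.fun_comp (g := h) (f := fun q : ℝ × ℝ => (q.2, (0 : ℝ))) hh (by fun_prop)
    have hFm := dslope_fst_mul F (by simp [F])
    refine ⟨fun j => if j < k then a j else fun u => h (u, 0),
      fun q => dslope (fun r => F (r, q.1)) 0 q.2, ?_, ?_, ?_⟩
    · intro j
      dsimp only
      split_ifs
      exacts [ha j, hb]
    · exact AnalyticAt.fun_comp (g := fun q : ℝ × ℝ => dslope (fun r => F (r, q.2)) 0 q.1)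
        (f := fun q : ℝ × ℝ => (q.2, q.1)) (x := ((0 : ℝ), (0 : ℝ))) hF.dslope_fst (by fun_prop)
    · intro q
      simp only [hGh, Finset.sum_range_succ, if_neg (lt_irrefl k)]
      have e1 : ∑ j ∈ Finset.range k, (if j < k then a j else fun u => h (u, 0)) q.1 * q.2 ^ j
          = ∑ j ∈ Finset.range k, a j q.1 * q.2 ^ j :=
        Finset.sum_congr rfl fun j hj => by rw [if_pos (Finset.mem_range.1 hj)]
      have e2 := hFm (q.2, q.1)
      simp only [F] at e2 ⊢
      rw [e1, pow_succ, mul_assoc (q.2 ^ k), ← e2]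
      ring

/-- The Taylor coefficients are determined by the derivatives. -/
theorem iteratedDeriv_sum_add_pow_mul {k : ℕ} {a : ℕ → ℝ} {h : ℝ → ℝ} (hh : AnalyticAt ℝ h 0)
    {j : ℕ} (hj : j < k) :
    iteratedDeriv j (fun w => ∑ i ∈ Finset.range k, a i * w ^ i + w ^ k * h w) 0
      = j.factorial * a j := by
  have hp : AnalyticAt ℝ (fun w : ℝ => w ^ k * h w) 0 := by fun_prop
  have h0 : iteratedDeriv j (fun w : ℝ => w ^ k * h w) 0 = 0 := by
    refine (natCast_le_analyticOrderAt_iff_iteratedDeriv_eq_zero (n := k) hp).1 ?_ j hj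
    rw [natCast_le_analyticOrderAt hp]
    exact ⟨h, hh, by simp⟩
  have hs : AnalyticAt ℝ (fun w : ℝ => ∑ i ∈ Finset.range k, a i * w ^ i) 0 :=
    Finset.analyticAt_fun_sum _ fun i _ => by fun_prop
  rw [iteratedDeriv_fun_add hs.contDiffAt hp.contDiffAt, h0, add_zero]
  rw [iteratedDeriv_fun_sum (fun i _ => by fun_prop)]
  simp only [iteratedDeriv_const_mul_field, iteratedDeriv_fun_pow_zero]
  rw [Finset.sum_eq_single j]
  · simp [mul_comm]
  · intro b _ hb
    simp [hb.symm]
  · simp [hj]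

end Division

/-! ### Puiseux arcs and the Newton polygon. -/

section Puiseux

/-- A polynomial of degree `k + 1` without term of degree `k` is a `(k + 1)`-st power only if it
is a monomial. -/
theorem exists_iteratedDeriv_ne_zero_of_coeff_eq_zero {k : ℕ} {β : ℕ → ℝ} {d : ℝ} (hd : d ≠ 0)
    (hk : β k = 0) (hβ : ∃ j < k + 1, β j ≠ 0) (c : ℝ) :
    ∃ j ≤ k, iteratedDeriv j
      (fun w => ∑ i ∈ Finset.range (k + 1), β i * w ^ i + w ^ (k + 1) * d) c ≠ 0 := by
  by_contra! h
  -- As the coefficient of `w ^ k` vanishes, the `k`-th derivative at `c` is a nonzero multiple of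
  -- `d * c`. Thus `c = 0`, where the derivatives read off the `β j`.
  have h1 := h k le_rfl
  rw [iteratedDeriv_fun_add (by fun_prop) (by fun_prop),
    iteratedDeriv_fun_sum (fun i _ => by fun_prop), Finset.sum_eq_zero, zero_add] at h1
  · simp only [mul_comm _ d, iteratedDeriv_const_mul_field, iteratedDeriv_pow] at h1
    have h2 : ((k + 1).descFactorial k : ℝ) ≠ 0 := by
      rw [Nat.cast_ne_zero, Ne, Nat.descFactorial_eq_zero_iff_lt]
      lia
    have hc : c = 0 := by simpa [hd, h2] using h1
    subst hc
    obtain ⟨j, hj, hβj⟩ := hβ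
    have h3 := h j (by lia)
    rw [iteratedDeriv_sum_add_pow_mul (h := fun _ => d) analyticAt_const hj] at h3
    simp [hβj, Nat.factorial_ne_zero] at h3
  · intro i hi
    rw [iteratedDeriv_const_mul_field, iteratedDeriv_pow]
    rcases Nat.lt_succ_iff_lt_or_eq.1 (Finset.mem_range.1 hi) with h2 | h2
    · rw [Nat.descFactorial_eq_zero_iff_lt.2 h2]; simp
    · rw [h2, hk, zero_mul]

/-- A set in the half plane `{q | 0 < q.1}` is covered by finitely many Puiseux arcs
`σ ↦ (σ ^ N, φ σ)`, `σ > 0`, with `φ` analytic at `0`. -/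
def PuiseuxCovered (Z : Set (ℝ × ℝ)) : Prop :=
  ∃ S : Set (ℕ × (ℝ → ℝ)), S.Finite ∧ (∀ s ∈ S, s.1 ≠ 0 ∧ AnalyticAt ℝ s.2 0) ∧
    ∀ q ∈ Z, ∃ s ∈ S, ∃ σ : ℝ, 0 < σ ∧ q = (σ ^ s.1, s.2 σ)

theorem puiseuxCovered_empty : PuiseuxCovered ∅ := ⟨∅, by simp, by simp, by simp⟩

theorem PuiseuxCovered.mono {Y Z : Set (ℝ × ℝ)} (h : PuiseuxCovered Z) (hYZ : Y ⊆ Z) :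
    PuiseuxCovered Y := by
  obtain ⟨S, h1, h2, h3⟩ := h
  exact ⟨S, h1, h2, fun q hq => h3 q (hYZ hq)⟩

theorem PuiseuxCovered.union {Y Z : Set (ℝ × ℝ)} (hY : PuiseuxCovered Y) (hZ : PuiseuxCovered Z) :
    PuiseuxCovered (Y ∪ Z) := by
  obtain ⟨S, h1, h2, h3⟩ := hY
  obtain ⟨T, h4, h5, h6⟩ := hZ
  refine ⟨S ∪ T, h1.union h4, ?_, ?_⟩
  · rintro s (hs | hs)
    exacts [h2 s hs, h5 s hs]
  · rintro q (hq | hq)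
    · obtain ⟨s, hs, h⟩ := h3 q hq
      exact ⟨s, Or.inl hs, h⟩
    · obtain ⟨s, hs, h⟩ := h6 q hq
      exact ⟨s, Or.inr hs, h⟩

/-- Puiseux arcs are preserved by `(s, z) ↦ (s ^ M, ψ (s ^ M) + s ^ e z)`. -/
theorem PuiseuxCovered.of_substitution {Y Z : Set (ℝ × ℝ)} {M e : ℕ} {ψ : ℝ → ℝ} (hM : M ≠ 0)
    (hψ : AnalyticAt ℝ ψ 0) (hZ : PuiseuxCovered Z)
    (h : ∀ q ∈ Y, ∃ p ∈ Z, q = (p.1 ^ M, ψ (p.1 ^ M) + p.1 ^ e * p.2)) : PuiseuxCovered Y := by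
  obtain ⟨S, h1, h2, h3⟩ := hZ
  refine ⟨(fun s : ℕ × (ℝ → ℝ) =>
      (s.1 * M, fun σ => ψ (σ ^ (s.1 * M)) + σ ^ (s.1 * e) * s.2 σ)) '' S, h1.image _, ?_, ?_⟩
  · rintro _ ⟨s, hs, rfl⟩
    obtain ⟨hs1, hs2⟩ := h2 s hs
    refine ⟨mul_ne_zero hs1 hM, ?_⟩
    have h4 : AnalyticAt ℝ (fun σ : ℝ => ψ (σ ^ (s.1 * M))) 0 := by
      refine AnalyticAt.fun_comp (g := ψ) (f := fun σ : ℝ => σ ^ (s.1 * M)) ?_ (by fun_prop)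
      rwa [zero_pow (mul_ne_zero hs1 hM)]
    exact h4.add (AnalyticAt.mul (by fun_prop) hs2)
  · intro q hq
    obtain ⟨p, hp, rfl⟩ := h q hq
    obtain ⟨s, hs, σ, hσ, rfl⟩ := h3 p hp
    refine ⟨_, ⟨s, hs, rfl⟩, σ, hσ, ?_⟩
    simp only [pow_mul]

/-- The convention `b = 0` for an identically vanishing `a` lets zero coefficients pass through the
Newton polygon without separate treatment. -/
theorem exists_eventually_eq_pow_mul {a : ℝ → ℝ} (ha : AnalyticAt ℝ a 0) (h0 : a 0 = 0) :
    ∃ (n : ℕ) (b : ℝ → ℝ), AnalyticAt ℝ b 0 ∧ (∀ᶠ u in 𝓝 0, a u = u ^ n * b u) ∧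
      ((¬ ∀ᶠ u in 𝓝 0, a u = 0) → b 0 ≠ 0 ∧ n ≠ 0) ∧ ((∀ᶠ u in 𝓝 0, a u = 0) → b = 0) := by
  by_cases h : ∀ᶠ u in 𝓝 0, a u = 0
  · exact ⟨0, 0, analyticAt_const, by simpa using h, fun h' => absurd h h', fun _ => rfl⟩
  · obtain ⟨n, b, hb, hb0, hab⟩ := (ha.exists_eventuallyEq_pow_smul_nonzero_iff).2 h
    simp only [sub_zero, smul_eq_mul] at hab
    refine ⟨n, b, hb, hab, fun _ => ⟨hb0, ?_⟩, fun h' => absurd h' h⟩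
    rintro rfl
    have := hab.self_of_nhds
    simp only [pow_zero, one_mul, h0] at this
    exact hb0 this.symm

/-- The first slope of the Newton polygon, after a ramification making it integral. -/
theorem exists_newton_slope {k : ℕ} {a : ℕ → ℝ → ℝ} (ha : ∀ j, AnalyticAt ℝ (a j) 0)
    (h0 : ∀ j < k + 1, a j 0 = 0) (hne : ∃ j < k + 1, ¬ ∀ᶠ u in 𝓝 0, a j u = 0) :
    ∃ (M e : ℕ) (B : ℕ → ℝ → ℝ), M ≠ 0 ∧ e ≠ 0 ∧ (∀ j < k + 1, AnalyticAt ℝ (B j) 0) ∧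
      (∀ j < k + 1, ∀ᶠ s in 𝓝 0, a j (s ^ M) = s ^ (e * (k + 1 - j)) * B j s) ∧
      ∃ j < k + 1, B j 0 ≠ 0 := by
  classical
  have hex : ∀ j, ∃ (n : ℕ) (b : ℝ → ℝ), j < k + 1 → AnalyticAt ℝ b 0 ∧
      (∀ᶠ u in 𝓝 0, a j u = u ^ n * b u) ∧
      ((¬ ∀ᶠ u in 𝓝 0, a j u = 0) → b 0 ≠ 0 ∧ n ≠ 0) ∧ ((∀ᶠ u in 𝓝 0, a j u = 0) → b = 0) := by
    intro j
    by_cases hj : j < k + 1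
    · obtain ⟨n, b, h⟩ := exists_eventually_eq_pow_mul (ha j) (h0 j hj)
      exact ⟨n, b, fun _ => h⟩
    · exact ⟨0, 0, fun h => absurd h hj⟩
  choose n b hnb using hex
  -- The factorial is divisible by every `k + 1 - j`, so that all slopes `ee j = M * n j / (k + 1 -
  -- j)` are integers.
  set M := (k + 1).factorial
  have hM : M ≠ 0 := Nat.factorial_ne_zero _
  have hdvd : ∀ j < k + 1, (M / (k + 1 - j)) * (k + 1 - j) = M := fun j hj =>
    Nat.div_mul_cancel (Nat.dvd_factorial (by lia) (by lia))
  let ee : ℕ → ℕ := fun j => n j * (M / (k + 1 - j))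
  have hee : ∀ j < k + 1, ee j * (k + 1 - j) = M * n j := by
    intro j hj
    simp only [ee]
    rw [mul_assoc, hdvd j hj, mul_comm]
  let A := (Finset.range (k + 1)).filter fun j => ¬ ∀ᶠ u in 𝓝 0, a j u = 0
  have hA : A.Nonempty := by
    obtain ⟨j, hj, hj'⟩ := hne
    exact ⟨j, by simp only [A, Finset.mem_filter, Finset.mem_range]; exact ⟨hj, hj'⟩⟩
  obtain ⟨i, hiA, himin⟩ := Finset.exists_min_image A ee hA
  have hi : i < k + 1 ∧ ¬ ∀ᶠ u in 𝓝 0, a i u = 0 := by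
    simpa only [A, Finset.mem_filter, Finset.mem_range] using hiA
  have hbi := (hnb i hi.1).2.2.1 hi.2
  -- The least slope leaves nonnegative exponents. Truncated subtraction matters only for `j`
  -- outside `A`, where `b j = 0`.
  refine ⟨M, ee i, fun j s => s ^ ((ee j - ee i) * (k + 1 - j)) * b j (s ^ M), hM, ?_, ?_, ?_, ?_⟩
  · intro h
    have := hee i hi.1
    rw [h, zero_mul] at this
    exact mul_ne_zero hM hbi.2 this.symm
  · intro j hj
    have h1 : AnalyticAt ℝ (fun s : ℝ => b j (s ^ M)) 0 := by
      refine AnalyticAt.fun_comp (g := b j) (f := fun s : ℝ => s ^ M) ?_ (by fun_prop)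
      rw [zero_pow hM]
      exact (hnb j hj).1
    exact AnalyticAt.mul (by fun_prop) h1
  · intro j hj
    have ht : Tendsto (fun s : ℝ => s ^ M) (𝓝 0) (𝓝 0) := by
      have : Continuous fun s : ℝ => s ^ M := by fun_prop
      simpa [zero_pow hM] using this.tendsto 0
    filter_upwards [ht.eventually (hnb j hj).2.1] with s hs
    by_cases hz : ∀ᶠ u in 𝓝 0, a j u = 0
    · rw [hs, (hnb j hj).2.2.2 hz]
      simp
    · have hjA : j ∈ A := by
        simp only [A, Finset.mem_filter, Finset.mem_range]; exact ⟨hj, hz⟩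
      rw [hs, ← mul_assoc, ← pow_add, ← add_mul, Nat.add_sub_cancel' (himin j hjA), hee j hj,
        pow_mul]
  · exact ⟨i, hi.1, by simpa [zero_pow hM] using hbi.1⟩

/-- Uniform bound for the roots of perturbed polynomials. -/
theorem exists_root_bound {k : ℕ} {B : ℕ → ℝ → ℝ} {h : ℝ × ℝ → ℝ}
    (hB : ∀ j < k + 1, ContinuousAt (B j) 0) (hh : ContinuousAt h (0, 0)) (h0 : h (0, 0) ≠ 0) :
    ∃ C ρ : ℝ, 0 < ρ ∧ ∀ s : ℝ, |s| < ρ → ∀ q : ℝ × ℝ, ‖q‖ < ρ → ∀ z : ℝ, C < |z| →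
      ∑ j ∈ Finset.range (k + 1), B j s * z ^ j + z ^ (k + 1) * h q ≠ 0 := by
  -- For `|z| > 1` the lower terms are at most `b |z| ^ k`, while the leading one exceeds `η |z| ^
  -- (k + 1)`; hence no root has `|z| > b / η`. The point `q` is kept independent of `z`, because
  -- `h` will be evaluated at `(s ^ M, s ^ e * z)` with `z` not yet bounded.
  set b := ∑ j ∈ Finset.range (k + 1), (|B j 0| + 1)
  set η := |h (0, 0)| / 2
  have hη : 0 < η := by positivity
  have hb : 0 ≤ b := by positivity
  have hB' : ∀ᶠ s in 𝓝 (0 : ℝ), ∀ j ∈ Finset.range (k + 1), |B j s| ≤ |B j 0| + 1 := by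
    rw [Filter.eventually_all_finset]
    intro j hj
    have := (hB j (Finset.mem_range.1 hj)).abs.eventually (gt_mem_nhds (lt_add_one |B j 0|))
    exact this.mono fun s hs => hs.le
  have hh' : ∀ᶠ q in 𝓝 ((0 : ℝ), (0 : ℝ)), η < |h q| :=
    hh.abs.eventually (lt_mem_nhds (half_lt_self (abs_pos.2 h0)))
  obtain ⟨ρ₁, hρ₁, h₁⟩ := Metric.eventually_nhds_iff.1 hB'
  obtain ⟨ρ₂, hρ₂, h₂⟩ := Metric.eventually_nhds_iff.1 hh'
  refine ⟨max 1 (b / η), min ρ₁ ρ₂, lt_min hρ₁ hρ₂, fun s hs q hq z hz hzero => ?_⟩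
  replace hs := h₁ (y := s) (by rw [Real.dist_0_eq_abs]; exact hs.trans_le (min_le_left _ _))
  replace hq := h₂ (y := q) (by
    rw [Prod.mk_zero_zero, dist_zero_right]; exact hq.trans_le (min_le_right _ _))
  have hz1 : 1 < |z| := (le_max_left _ _).trans_lt hz
  have hz2 : b < η * |z| := by
    have := (le_max_right _ _).trans_lt hz
    rwa [div_lt_iff₀' hη] at this
  have h1 : |∑ j ∈ Finset.range (k + 1), B j s * z ^ j| ≤ b * |z| ^ k := by
    refine (Finset.abs_sum_le_sum_abs _ _).trans ?_
    rw [Finset.sum_mul]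
    refine Finset.sum_le_sum fun j hj => ?_
    rw [abs_mul, abs_pow]
    have : |z| ^ j ≤ |z| ^ k :=
      pow_le_pow_right₀ hz1.le (Nat.lt_succ_iff.1 (Finset.mem_range.1 hj))
    have := hs j hj
    gcongr
  have h2 : |z ^ (k + 1) * h q| ≤ b * |z| ^ k := by
    rw [show z ^ (k + 1) * h q = -∑ j ∈ Finset.range (k + 1), B j s * z ^ j by linarith, abs_neg]
    exact h1
  rw [abs_mul, abs_pow, pow_succ] at h2
  have hzk : 0 < |z| ^ k := by positivity
  have h3 : |z| * |h q| ≤ b := by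
    have : |z| ^ k * (|z| * |h q|) ≤ |z| ^ k * b := by linarith
    exact le_of_mul_le_mul_left this hzk
  nlinarith

end Puiseux

/-! ### Newton–Puiseux induction on the multiplicity. -/

section Puiseux

/-- The substitution `u = s ^ M`, `v = s ^ e z` along the first Newton slope extracts `s ^ (e (k +
1))`. What remains at `s = 0` is a polynomial in `z` of degree `k + 1` with no term of degree `k`
and some nonzero lower coefficient. It is not a pure power, so each root has multiplicity at most
`k` and `ih` applies. -/
theorem exists_puiseuxCovered_of_coeff_eq_zero {k : ℕ}
    (ih : ∀ (G : ℝ × ℝ → ℝ) (c : ℝ), AnalyticAt ℝ G (0, c) →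
      (∃ j ≤ k, iteratedDeriv j (fun w => G (0, w)) c ≠ 0) →
      ∃ U ∈ 𝓝 ((0 : ℝ), c), PuiseuxCovered {q | q ∈ U ∧ 0 < q.1 ∧ G q = 0})
    {a : ℕ → ℝ → ℝ} {h : ℝ × ℝ → ℝ} (ha : ∀ j, AnalyticAt ℝ (a j) 0)
    (h0 : ∀ j < k + 1, a j 0 = 0) (hk : ∀ᶠ u in 𝓝 0, a k u = 0)
    (hh : AnalyticAt ℝ h (0, 0)) (hh0 : h (0, 0) ≠ 0) :
    ∃ U ∈ 𝓝 ((0 : ℝ), (0 : ℝ)), PuiseuxCovered {q | q ∈ U ∧ 0 < q.1 ∧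
      ∑ j ∈ Finset.range (k + 1), a j q.1 * q.2 ^ j + q.2 ^ (k + 1) * h q = 0} := by
  by_cases hne : ∃ j < k + 1, ¬ ∀ᶠ u in 𝓝 0, a j u = 0
  · obtain ⟨M, e, B, hM, he, hBa, haB, hBne⟩ := exists_newton_slope ha h0 hne
    have hk1 := Nat.lt_succ_self k
    have hBk : B k 0 = 0 := by
      by_contra hne0
      have ht : Tendsto (fun s : ℝ => s ^ M) (𝓝 0) (𝓝 0) := by
        have : Continuous fun s : ℝ => s ^ M := by fun_prop
        simpa [zero_pow hM] using this.tendsto 0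
      have h1 : ∀ᶠ s in 𝓝[≠] (0 : ℝ), False := by
        filter_upwards [self_mem_nhdsWithin, (haB k hk1).filter_mono nhdsWithin_le_nhds,
          (ht.eventually hk).filter_mono nhdsWithin_le_nhds,
          ((hBa k hk1).continuousAt.eventually_ne hne0).filter_mono nhdsWithin_le_nhds]
          with s hs h2 h3 h4
        rw [h3, eq_comm, mul_eq_zero] at h2
        exact h2.elim (pow_ne_zero _ hs) h4
      exact h1.exists.elim fun _ => id
    let Φ : ℝ × ℝ → ℝ × ℝ := fun q => (q.1 ^ M, q.1 ^ e * q.2)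
    have hΦ : ∀ c, AnalyticAt ℝ Φ (0, c) := fun c => by
      refine AnalyticAt.prod ?_ ?_ <;> fun_prop
    have hΦ0 : ∀ c, Φ (0, c) = (0, 0) := by simp [Φ, hM, he]
    let G : ℝ × ℝ → ℝ := fun q =>
      ∑ j ∈ Finset.range (k + 1), B j q.1 * q.2 ^ j + q.2 ^ (k + 1) * h (Φ q)
    have hG : ∀ c, AnalyticAt ℝ G (0, c) := by
      intro c
      refine AnalyticAt.add (Finset.analyticAt_fun_sum _ fun j hj => ?_) ?_
      · refine AnalyticAt.mul ?_ (by fun_prop)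
        exact AnalyticAt.fun_comp (g := B j) (f := Prod.fst) (x := ((0 : ℝ), c))
          (hBa j (Finset.mem_range.1 hj)) analyticAt_fst
      · refine AnalyticAt.mul (by fun_prop) (AnalyticAt.fun_comp (g := h) (f := Φ) ?_ (hΦ c))
        rwa [hΦ0]
    have hGcov : ∀ c, ∃ U ∈ 𝓝 ((0 : ℝ), c), PuiseuxCovered {q | q ∈ U ∧ 0 < q.1 ∧ G q = 0} := by
      intro c
      refine ih G c (hG c) ?_
      simp only [G, hΦ0]
      exact exists_iteratedDeriv_ne_zero_of_coeff_eq_zero hh0 hBk hBne c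
    obtain ⟨C, ρ, hρ, hC⟩ := exists_root_bound (fun j hj => (hBa j hj).continuousAt)
      hh.continuousAt hh0
    -- The root bound confines `z` to a compact interval, over which finitely many of the local
    -- coverings suffice.
    have hcomp : ∃ δ > 0, PuiseuxCovered
        {q | 0 < q.1 ∧ q.1 < δ ∧ q.2 ∈ Set.Icc (-C) C ∧ G q = 0} := by
      refine isCompact_Icc.induction_on
        (p := fun A => ∃ δ > 0, PuiseuxCovered {q | 0 < q.1 ∧ q.1 < δ ∧ q.2 ∈ A ∧ G q = 0})
        ?_ ?_ ?_ ?_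
      · exact ⟨1, one_pos, puiseuxCovered_empty.mono fun q hq => hq.2.2.1⟩
      · rintro s t hst ⟨δ, hδ, h1⟩
        exact ⟨δ, hδ, h1.mono fun q hq => ⟨hq.1, hq.2.1, hst hq.2.2.1, hq.2.2.2⟩⟩
      · rintro s t ⟨δ, hδ, h1⟩ ⟨δ', hδ', h2⟩
        refine ⟨min δ δ', lt_min hδ hδ', (h1.union h2).mono ?_⟩
        rintro q ⟨hq1, hq2, hq3 | hq3, hq4⟩
        · exact Or.inl ⟨hq1, hq2.trans_le (min_le_left _ _), hq3, hq4⟩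
        · exact Or.inr ⟨hq1, hq2.trans_le (min_le_right _ _), hq3, hq4⟩
      · intro c _
        obtain ⟨U, hU, hcov⟩ := hGcov c
        obtain ⟨δ, hδ, hδU⟩ := Metric.mem_nhds_iff.1 hU
        refine ⟨Metric.ball c δ, mem_nhdsWithin_of_mem_nhds (Metric.ball_mem_nhds _ hδ), δ, hδ,
          hcov.mono ?_⟩
        rintro q ⟨hq1, hq2, hq3, hq4⟩
        refine ⟨hδU ?_, hq1, hq4⟩
        rw [Metric.mem_ball, Prod.dist_eq, max_lt_iff]
        exact ⟨by rwa [Real.dist_0_eq_abs, abs_of_pos hq1], hq3⟩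
    obtain ⟨δ, hδ, hcov⟩ := hcomp
    have hallB : ∀ᶠ s in 𝓝 (0 : ℝ), ∀ j ∈ Finset.range (k + 1),
        a j (s ^ M) = s ^ (e * (k + 1 - j)) * B j s := by
      rw [Filter.eventually_all_finset]
      exact fun j hj => haB j (Finset.mem_range.1 hj)
    obtain ⟨δ', hδ', hB'⟩ := Metric.eventually_nhds_iff.1 hallB
    -- The three bounds on `s` serve the covering, the factorisation of the coefficients and the
    -- root bound; `κ ^ M` is the matching bound on `u = s ^ M`.
    set κ := min (min δ δ') ρ
    have hκ : 0 < κ := lt_min (lt_min hδ hδ') hρ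
    refine ⟨Metric.ball (0, 0) (min ρ (κ ^ M)),
      Metric.ball_mem_nhds _ (lt_min hρ (pow_pos hκ M)), ?_⟩
    refine hcov.of_substitution (M := M) (e := e) (ψ := fun _ => 0) hM analyticAt_const ?_
    rintro ⟨u, v⟩ ⟨hq, hu, hzero⟩
    dsimp only at hu hzero
    rw [Prod.mk_zero_zero, mem_ball_zero_iff, lt_min_iff] at hq
    have huκ : u < κ ^ M := lt_of_le_of_lt ((le_abs_self u).trans (norm_fst_le (u, v))) hq.2
    obtain ⟨s, hs, rfl⟩ : ∃ s : ℝ, 0 < s ∧ s ^ M = u :=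
      ⟨u ^ ((M : ℝ)⁻¹), Real.rpow_pos_of_pos hu _, Real.rpow_inv_natCast_pow hu.le hM⟩
    have hsκ : s < κ := lt_of_pow_lt_pow_left₀ M hκ.le huκ
    obtain ⟨z, rfl⟩ : ∃ z, s ^ e * z = v := ⟨v / s ^ e, by field_simp⟩
    have hsum : ∑ j ∈ Finset.range (k + 1), a j (s ^ M) * (s ^ e * z) ^ j
        + (s ^ e * z) ^ (k + 1) * h (s ^ M, s ^ e * z) = s ^ (e * (k + 1)) * G (s, z) := by
      simp only [G, Φ]
      rw [mul_add, Finset.mul_sum]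
      congr 1
      · refine Finset.sum_congr rfl fun j hj => ?_
        have hj' : j ≤ k + 1 := (Finset.mem_range.1 hj).le
        rw [hB' (y := s) (by
          rw [Real.dist_0_eq_abs, abs_of_pos hs]
          exact hsκ.trans_le ((min_le_left _ _).trans (min_le_right _ _))) j hj]
        have : s ^ (e * (k + 1)) = s ^ (e * (k + 1 - j)) * s ^ (e * j) := by
          rw [← pow_add, ← mul_add, Nat.sub_add_cancel hj']
        rw [this, mul_pow, ← pow_mul]
        ring
      · rw [mul_pow, ← pow_mul]; ring
    rw [hsum, mul_eq_zero] at hzero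
    have hGz : G (s, z) = 0 := hzero.resolve_left (pow_ne_zero _ hs.ne')
    refine ⟨(s, z), ⟨hs, hsκ.trans_le ((min_le_left _ _).trans (min_le_left _ _)), ?_, hGz⟩,
      by simp⟩
    rw [Set.mem_Icc, ← abs_le]
    by_contra! hCz
    refine hC s ?_ (s ^ M, s ^ e * z) hq.1 z hCz hGz
    rw [abs_of_pos hs]
    exact hsκ.trans_le (min_le_right _ _)
  -- With all lower coefficients zero, the zero set is the single arc `v = 0`.
  · push Not at hne
    have hall : ∀ᶠ u in 𝓝 (0 : ℝ), ∀ j ∈ Finset.range (k + 1), a j u = 0 := by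
      rw [Filter.eventually_all_finset]
      exact fun j hj => hne j (Finset.mem_range.1 hj)
    have h1 : ∀ᶠ q in 𝓝 ((0 : ℝ), (0 : ℝ)), (∀ j ∈ Finset.range (k + 1), a j q.1 = 0) ∧ h q ≠ 0 :=
      ((continuous_fst.tendsto ((0 : ℝ), (0 : ℝ))).eventually hall).and
        (hh.continuousAt.eventually_ne hh0)
    refine ⟨_, h1, {(1, fun _ => 0)}, by simp, ?_, ?_⟩
    · rintro s rfl
      exact ⟨one_ne_zero, analyticAt_const⟩
    · rintro ⟨u, v⟩ ⟨⟨hq1, hq2⟩, hu, hzero⟩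
      refine ⟨_, rfl, u, hu, ?_⟩
      dsimp only at hzero hq1
      rw [Finset.sum_eq_zero fun j hj => by rw [hq1 j hj, zero_mul], zero_add, mul_eq_zero] at hzero
      have hv : v = 0 := pow_eq_zero_iff (by simp) |>.1 (hzero.resolve_right hq2)
      simp [hv]

/-- The iterated partial derivatives of an analytic function are analytic. -/
theorem AnalyticAt.iteratedDeriv_snd {G : ℝ × ℝ → ℝ} {p : ℝ × ℝ} (hG : AnalyticAt ℝ G p) (j : ℕ) :
    AnalyticAt ℝ (fun q : ℝ × ℝ => iteratedDeriv j (fun w => G (q.1, w)) q.2) p := by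
  induction j with
  | zero => simpa using hG
  | succ j ih =>
    refine (ih.fderiv_apply_const (0, 1)).congr ?_
    filter_upwards [ih.eventually_analyticAt] with q hq
    rw [iteratedDeriv_succ]
    exact hq.hasDerivAt_snd.deriv.symm

/-- The analytic implicit function theorem in two variables. -/
theorem AnalyticAt.exists_implicit {T : ℝ × ℝ → ℝ} {c : ℝ} (hT : AnalyticAt ℝ T (0, c))
    (h0 : T (0, c) = 0) (h1 : deriv (fun w => T (0, w)) c ≠ 0) :
    ∃ ψ : ℝ → ℝ, AnalyticAt ℝ ψ 0 ∧ ψ 0 = c ∧ ∀ᶠ u in 𝓝 0, T (u, ψ u) = 0 := by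
  have cdf : ContDiffAt ℝ ⊤ T (0, c) := hT.contDiffAt
  have hne : (⊤ : WithTop ℕ∞) ≠ 0 := by simp
  have hd : fderiv ℝ T (0, c) (0, 1) ≠ 0 := by rwa [← hT.hasDerivAt_snd.deriv]
  have inv : (fderiv ℝ T (0, c) ∘L .inr ℝ ℝ ℝ).IsInvertible := by
    refine ⟨ContinuousLinearEquiv.unitsEquivAut ℝ (Units.mk0 _ hd), ?_⟩
    ext
    simp
  refine ⟨cdf.implicitFunction hne inv, (cdf.contDiffAt_implicitFunction hne inv).analyticAt,
    cdf.implicitFunction_apply_self hne inv, ?_⟩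
  have := cdf.eventually_apply_implicitFunction hne inv
  rwa [h0] at this

/-- The zeros of an analytic function of two variables in a half disc are covered by finitely
many Puiseux arcs. -/
theorem exists_puiseuxCovered (k : ℕ) : ∀ (G : ℝ × ℝ → ℝ) (c : ℝ), AnalyticAt ℝ G (0, c) →
    (∃ j ≤ k, iteratedDeriv j (fun w => G (0, w)) c ≠ 0) →
    ∃ U ∈ 𝓝 ((0 : ℝ), c), PuiseuxCovered {q | q ∈ U ∧ 0 < q.1 ∧ G q = 0} := by
  induction k with
  | zero =>
    rintro G c hG ⟨j, hj, hne⟩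
    obtain rfl : j = 0 := by lia
    rw [iteratedDeriv_zero] at hne
    exact ⟨_, hG.continuousAt.eventually_ne hne,
      puiseuxCovered_empty.mono fun q hq => hq.1 hq.2.2⟩
  | succ k ih =>
    intro G c hG hj
    by_cases hlow : ∃ j ≤ k, iteratedDeriv j (fun w => G (0, w)) c ≠ 0
    · exact ih G c hG hlow
    push Not at hlow
    have htop : iteratedDeriv (k + 1) (fun w => G (0, w)) c ≠ 0 := by
      obtain ⟨j, hjk, hne⟩ := hj
      rcases Nat.le_succ_iff.1 hjk with h | rfl
      · exact absurd (hlow j h) hne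
      · exact hne
    -- Analytic Tschirnhaus transformation: recentring at the zero `ψ u` of the `k`-th derivative in
    -- `w` kills the coefficient of degree `k`.
    obtain ⟨ψ, hψ, hψ0, hψT⟩ := (hG.iteratedDeriv_snd k).exists_implicit (hlow k le_rfl)
      (by rwa [iteratedDeriv_succ] at htop)
    let G₁ : ℝ × ℝ → ℝ := fun q => G (q.1, ψ q.1 + q.2)
    have hψ1 : AnalyticAt ℝ (fun q : ℝ × ℝ => ψ q.1) (0, 0) :=
      AnalyticAt.fun_comp (g := ψ) (f := Prod.fst) (x := ((0 : ℝ), (0 : ℝ))) hψ analyticAt_fst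
    have hG₁ : AnalyticAt ℝ G₁ (0, 0) := by
      refine AnalyticAt.fun_comp (g := G) (f := fun q : ℝ × ℝ => (q.1, ψ q.1 + q.2)) ?_
        (analyticAt_fst.prod (hψ1.add analyticAt_snd))
      simpa [hψ0] using hG
    have hder : ∀ j u, iteratedDeriv j (fun v => G₁ (u, v)) 0
        = iteratedDeriv j (fun w => G (u, w)) (ψ u) := by
      intro j u
      have := congrFun (iteratedDeriv_comp_const_add j (fun w => G (u, w)) (ψ u)) 0
      simpa using this
    obtain ⟨a, h, ha, hh, hsum⟩ := hG₁.exists_taylor_snd (k + 1)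
    have hcoef : ∀ᶠ u in 𝓝 (0 : ℝ), ∀ j < k + 1,
        iteratedDeriv j (fun w => G (u, w)) (ψ u) = j.factorial * a j u := by
      have hc : Tendsto (fun u : ℝ => (u, (0 : ℝ))) (𝓝 0) (𝓝 (0, 0)) :=
        Continuous.tendsto (by fun_prop) 0
      filter_upwards [hc.eventually hh.eventually_analyticAt] with u hu j hj
      rw [← hder]
      simp only [hsum]
      refine iteratedDeriv_sum_add_pow_mul (h := fun w => h (u, w)) ?_ hj
      exact AnalyticAt.fun_comp (g := h) (f := fun w : ℝ => (u, w)) hu (by fun_prop)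
    have ha0 : ∀ j < k + 1, a j 0 = 0 := by
      intro j hj
      have h1 := hcoef.self_of_nhds j hj
      rw [hψ0, hlow j (by lia)] at h1
      exact (mul_eq_zero.1 h1.symm).resolve_left (by exact_mod_cast Nat.factorial_ne_zero j)
    have hak : ∀ᶠ u in 𝓝 0, a k u = 0 := by
      filter_upwards [hcoef, hψT] with u h1 h2
      have h3 := h1 k (Nat.lt_succ_self k)
      rw [h2] at h3
      exact (mul_eq_zero.1 h3.symm).resolve_left (by exact_mod_cast Nat.factorial_ne_zero k)
    -- Otherwise `G₁ (0, ·)` would have order at least `k + 2`, contrary to `htop`.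
    have hh0 : h (0, 0) ≠ 0 := by
      intro h0
      have hl : AnalyticAt ℝ (fun v => G₁ (0, v)) 0 :=
        AnalyticAt.fun_comp (g := G₁) (f := fun v : ℝ => ((0 : ℝ), v)) hG₁ (by fun_prop)
      have hhl : AnalyticAt ℝ (fun v => h (0, v)) 0 :=
        AnalyticAt.fun_comp (g := h) (f := fun v : ℝ => ((0 : ℝ), v)) hh (by fun_prop)
      have heq : (fun v => G₁ (0, v)) = (fun v => v ^ (k + 1)) * fun v => h (0, v) := by
        ext v
        rw [hsum, Pi.mul_apply]
        rw [Finset.sum_eq_zero fun j hj => by rw [ha0 j (Finset.mem_range.1 hj), zero_mul],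
          zero_add]
      have hord : ((k + 2 : ℕ) : ℕ∞) ≤ analyticOrderAt (fun v => G₁ (0, v)) 0 := by
        rw [heq, analyticOrderAt_mul (f := fun v : ℝ => v ^ (k + 1)) (by fun_prop) hhl]
        have e1 : analyticOrderAt (fun v : ℝ => v ^ (k + 1)) 0 = ((k + 1 : ℕ) : ℕ∞) := by
          rw [show (fun v : ℝ => v ^ (k + 1)) = (fun v : ℝ => v - 0) ^ (k + 1) by ext v; simp]
          exact analyticOrderAt_centeredMonomial
        have e2 : 1 ≤ analyticOrderAt (fun v => h (0, v)) 0 := by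
          rw [Order.one_le_iff_ne_zero, hhl.analyticOrderAt_ne_zero]
          exact h0
        rw [e1]
        calc ((k + 2 : ℕ) : ℕ∞) = ((k + 1 : ℕ) : ℕ∞) + 1 := by push_cast; ring
          _ ≤ _ := by gcongr
      have := (natCast_le_analyticOrderAt_iff_iteratedDeriv_eq_zero hl).1 hord (k + 1) (by lia)
      rw [hder, hψ0] at this
      exact htop this
    obtain ⟨U, hU, hcov⟩ := exists_puiseuxCovered_of_coeff_eq_zero ih ha ha0 hak hh hh0
    have hcont : ContinuousAt (fun q : ℝ × ℝ => (q.1, q.2 - ψ q.1)) (0, c) := by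
      refine continuousAt_fst.prodMk (continuousAt_snd.sub ?_)
      exact ContinuousAt.comp (g := ψ) (f := Prod.fst) (x := ((0 : ℝ), c)) hψ.continuousAt
        continuousAt_fst
    refine ⟨_, hcont.preimage_mem_nhds (by simpa [hψ0] using hU), ?_⟩
    refine hcov.of_substitution (M := 1) (e := 0) one_ne_zero hψ ?_
    rintro q ⟨hqU, hq1, hq2⟩
    refine ⟨(q.1, q.2 - ψ q.1), ⟨hqU, hq1, ?_⟩, by simp⟩
    rw [← hsum]
    simpa [G₁] using hq2

end Puiseux

/-! ### One-way crossing of rays and convergence of the angle. -/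

section Crossing

/-- A function which is increasing at each of its zeros stays nonnegative. -/
theorem nonneg_of_deriv_pos_of_eq_zero {D D' : ℝ → ℝ} {T : ℝ}
    (hD : ∀ t ≥ T, HasDerivAt D (D' t) t) (h : ∀ t ≥ T, D t = 0 → 0 < D' t) (hT : 0 ≤ D T) :
    ∀ t ≥ T, 0 ≤ D t := by
  intro t ht
  have h1 := image_le_of_deriv_right_lt_deriv_boundary (f := fun t => -D t) (f' := fun t => -D' t)
    (a := T) (b := t) (fun s hs => (hD s hs.1).neg.continuousAt.continuousWithinAt)
    (fun s hs => (hD s hs.1).neg.hasDerivWithinAt) (B := fun _ => 0) (B' := fun _ => 0)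
    (by simpa using hT) (fun s => hasDerivAt_const s 0)
    (fun s hs h0 => by simpa using h s hs.1 (by simpa using h0)) (Set.right_mem_Icc.2 ht)
  simpa using h1

/-- A function which is increasing at each of its zeros has at most one zero. -/
theorem eventually_ne_zero_of_deriv_pos {D D' : ℝ → ℝ}
    (hD : ∀ᶠ t in atTop, HasDerivAt D (D' t) t) (h : ∀ᶠ t in atTop, D t = 0 → 0 < D' t) :
    ∀ᶠ t in atTop, D t ≠ 0 := by
  obtain ⟨T, hT⟩ := eventually_atTop.1 (hD.and h)
  by_cases hz : ∃ t₁ ≥ T, D t₁ = 0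
  · obtain ⟨t₁, ht₁, hz⟩ := hz
    have hnn := nonneg_of_deriv_pos_of_eq_zero (fun t ht => (hT t (ht₁.trans ht)).1)
      (fun t ht => (hT t (ht₁.trans ht)).2) hz.ge
    filter_upwards [eventually_gt_atTop t₁] with t ht h0
    have hd := hT t (ht₁.trans ht.le)
    have hmin : IsLocalMin D t := by
      filter_upwards [lt_mem_nhds ht] with s hs
      rw [h0]
      exact hnn s hs.le
    exact (hd.2 h0).ne' (hmin.hasDerivAt_eq_zero hd.1)
  · push Not at hz
    exact eventually_atTop.2 ⟨T, hz⟩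

/-- Otherwise `κ` is antitone, and a monotone periodic function is constant. -/
theorem exists_deriv_pos_of_periodic {κ : ℝ → ℝ} {P : ℝ} (hP : 0 < P)
    (hd : Differentiable ℝ κ) (hper : Function.Periodic κ P) {a b : ℝ} (hab : κ a ≠ κ b) :
    ∃ c, 0 < deriv κ c := by
  by_contra! h
  have hanti : Antitone κ := antitone_of_deriv_nonpos hd h
  have key : ∀ x y, κ y ≤ κ x := by
    intro x y
    obtain ⟨n, hn⟩ := exists_nat_gt ((x - y) / P)
    rw [div_lt_iff₀ hP] at hn
    have := hanti (show x ≤ y + n * P by linarith)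
    rwa [hper.nat_mul n y] at this
  exact hab (le_antisymm (key b a) (key a b))

/-- The angle of a gradient trajectory tending to the origin converges. -/
theorem exists_tendsto_angle {F : ℝ × ℝ → ℝ} (hF : ∀ c, AnalyticAt ℝ F (0, c))
    (hper : ∀ r, Function.Periodic (fun c => F (r, c)) (2 * Real.pi)) {r θ : ℝ → ℝ}
    (hr : ∀ᶠ t in atTop, 0 < r t) (hr0 : Tendsto r atTop (𝓝 0))
    (hθ : ∀ᶠ t in atTop, HasDerivAt θ (deriv (fun c => F (r t, c)) (θ t) / r t ^ 2) t) :
    ∃ θ₀, Tendsto θ atTop (𝓝 θ₀) := by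
  have hP : 0 < 2 * Real.pi := Real.two_pi_pos
  have hdper : ∀ r, Function.Periodic (deriv fun c => F (r, c)) (2 * Real.pi) := by
    intro r c
    rw [← deriv_comp_add_const]
    congr 1
    exact funext (hper r)
  -- Subtracting the radial part leaves `∂_θ F` unchanged and forces `κ 0 = 0`, so that a nonzero
  -- `κ` is nonconstant.
  let H : ℝ × ℝ → ℝ := fun q => F q - F (q.1, 0)
  have hH : ∀ c, AnalyticAt ℝ H (0, c) := fun c =>
    (hF c).sub (AnalyticAt.fun_comp (g := F) (f := fun q : ℝ × ℝ => (q.1, (0 : ℝ))) (hF 0)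
      (by fun_prop))
  have hdH : ∀ r c, deriv (fun w => F (r, w)) c = deriv (fun w => H (r, w)) c := fun r c => by
    simp [H]
  by_cases hall : ∀ c, ∀ᶠ q in 𝓝 ((0 : ℝ), c), H q = 0
  · have h1 : ∀ᶠ s in 𝓝 (0 : ℝ), ∀ c ∈ Set.Icc 0 (2 * Real.pi),
        deriv (fun w => F (s, w)) c = 0 := by
      refine isCompact_Icc.eventually_forall_of_forall_eventually fun c _ => ?_
      filter_upwards [(hall c).eventually_nhds] with q hq
      have h2 : ∀ᶠ w in 𝓝 q.2, H (q.1, w) = 0 := by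
        have : Tendsto (fun w => (q.1, w)) (𝓝 q.2) (𝓝 q) :=
          Continuous.tendsto (by fun_prop) q.2
        exact this.eventually hq
      rw [hdH, Filter.EventuallyEq.deriv_eq (f := fun _ => 0) h2, deriv_const]
    obtain ⟨T, hT⟩ := eventually_atTop.1 ((hr0.eventually h1).and hθ)
    have hzero : ∀ t ≥ T, HasDerivAt θ 0 t := by
      intro t ht
      have h2 := (hT t ht).2
      obtain ⟨c, hc, hce⟩ := (hdper (r t)).exists_mem_Ico₀ hP (θ t)
      rwa [hce, (hT t ht).1 c (Set.Ico_subset_Icc_self hc), zero_div] at h2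
    refine ⟨θ T, tendsto_const_nhds.congr' ?_⟩
    filter_upwards [eventually_ge_atTop T] with t ht
    exact (constant_of_has_deriv_right_zero
      (fun s hs => (hzero s hs.1).continuousAt.continuousWithinAt)
      (fun s hs => (hzero s hs.1).hasDerivWithinAt) t (Set.right_mem_Icc.2 ht)).symm
  · rw [not_forall] at hall
    obtain ⟨c₀, hc₀⟩ := hall
    obtain ⟨k, G, hG, hHG, c₁, hc₁⟩ := exists_eq_fst_pow_mul hH hc₀
    let κ : ℝ → ℝ := fun c => G (0, c)
    have hκ : ∀ c, AnalyticAt ℝ κ c := fun c =>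
      AnalyticAt.fun_comp (g := G) (f := fun c : ℝ => ((0 : ℝ), c)) (hG c) (by fun_prop)
    have hκd : Differentiable ℝ κ := fun c => (hκ c).differentiableAt
    have hlim : ∀ c, Tendsto (fun s : ℝ => G (s, c)) (𝓝[≠] 0) (𝓝 (κ c)) := by
      intro c
      have h1 : ContinuousAt (fun s : ℝ => G (s, c)) 0 :=
        ContinuousAt.comp (g := G) (f := fun s : ℝ => (s, c)) (hG c).continuousAt (by fun_prop)
      exact h1.tendsto.mono_left nhdsWithin_le_nhds
    have hκ0 : κ 0 = 0 := by
      refine tendsto_nhds_unique (hlim 0) (tendsto_const_nhds.congr' ?_)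
      filter_upwards [self_mem_nhdsWithin] with s hs
      have h1 := hHG (s, 0)
      simp only [H, sub_self] at h1
      exact ((mul_eq_zero.1 h1.symm).resolve_left (pow_ne_zero _ hs)).symm
    have hκper : Function.Periodic κ (2 * Real.pi) := by
      intro c
      refine tendsto_nhds_unique (hlim _) ((hlim c).congr' ?_)
      filter_upwards [self_mem_nhdsWithin] with s hs
      have h1 := hHG (s, c)
      have h2 := hHG (s, c + 2 * Real.pi)
      have h3 : F (s, c + 2 * Real.pi) = F (s, c) := hper s c
      simp only [H, h3] at h1 h2
      exact mul_left_cancel₀ (pow_ne_zero k hs) (h1.symm.trans h2)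
    have hne : κ c₁ ≠ κ 0 := by rw [hκ0]; exact hc₁
    obtain ⟨cp, hcp⟩ := exists_deriv_pos_of_periodic hP hκd hκper hne
    obtain ⟨cm, hcm⟩ : ∃ c, deriv κ c < 0 := by
      obtain ⟨c, hc⟩ := exists_deriv_pos_of_periodic hP hκd.neg (κ := fun c => -κ c)
        (fun c => by simp [hκper c]) (a := c₁) (b := 0) (by simpa using hne)
      exact ⟨c, by simpa using hc⟩
    -- The factor `ε`, later `1` or `-1`, treats both crossing directions at once; by periodicity
    -- the threshold is uniform over all lifts `c + 2πn` of a ray.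
    have hsign : ∀ ε c : ℝ, 0 < ε * deriv κ c → ∀ᶠ t in atTop, ∀ n : ℤ,
        θ t = c + n * (2 * Real.pi) →
          0 < ε * (deriv (fun c => F (r t, c)) (θ t) / r t ^ 2) := by
      intro ε c hc
      have h1 : ∀ᶠ s in 𝓝 (0 : ℝ), 0 < ε * fderiv ℝ G (s, c) (0, 1) ∧ AnalyticAt ℝ G (s, c) := by
        have ht : Tendsto (fun s : ℝ => (s, c)) (𝓝 0) (𝓝 (0, c)) :=
          Continuous.tendsto (by fun_prop) 0
        have h2 : ContinuousAt (fun q => ε * fderiv ℝ G q (0, 1)) (0, c) :=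
          continuousAt_const.mul ((hG c).fderiv_apply_const (0, 1)).continuousAt
        have h3 : 0 < ε * fderiv ℝ G (0, c) (0, 1) := by
          rwa [← (hG c).hasDerivAt_snd.deriv]
        exact (ht.eventually (h2.eventually (lt_mem_nhds h3))).and
          (ht.eventually (hG c).eventually_analyticAt)
      filter_upwards [hr0.eventually h1, hr] with t ht hrt n hn
      have h4 : deriv (fun c => F (r t, c)) (θ t) = r t ^ k * fderiv ℝ G (r t, c) (0, 1) := by
        rw [hn, (hdper (r t)).int_mul n c, hdH]
        simp only [hHG]
        rw [deriv_const_mul _ ht.2.hasDerivAt_snd.differentiableAt, ht.2.hasDerivAt_snd.deriv]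
      rw [h4]
      have : ε * (r t ^ k * fderiv ℝ G (r t, c) (0, 1) / r t ^ 2)
          = r t ^ k / r t ^ 2 * (ε * fderiv ℝ G (r t, c) (0, 1)) := by ring
      rw [this]
      exact mul_pos (by positivity) ht.1
    have hbarrier : ∀ ε c : ℝ, 0 < ε * deriv κ c → ∀ᶠ T in atTop, ∀ n : ℤ,
        0 ≤ ε * (θ T - (c + n * (2 * Real.pi))) →
        ∀ t ≥ T, 0 ≤ ε * (θ t - (c + n * (2 * Real.pi))) := by
      intro ε c hc
      obtain ⟨T₀, hT₀⟩ := eventually_atTop.1 ((hsign ε c hc).and hθ)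
      filter_upwards [eventually_ge_atTop T₀] with T hT n hn
      refine nonneg_of_deriv_pos_of_eq_zero
        (fun t ht => ((hT₀ t (hT.trans ht)).2.sub_const _).const_mul ε) ?_ hn
      intro t ht h0
      refine (hT₀ t (hT.trans ht)).1 n ?_
      have hε : ε ≠ 0 := by rintro rfl; simp at hc
      exact sub_eq_zero.1 ((mul_eq_zero.1 h0).resolve_left hε)
    have hup : IsBoundedUnder (· ≤ ·) atTop θ := by
      obtain ⟨T, hT⟩ := (hbarrier (-1) cm (by linarith)).exists
      obtain ⟨n, hn⟩ := exists_nat_gt ((θ T - cm) / (2 * Real.pi))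
      rw [div_lt_iff₀ hP] at hn
      refine ⟨cm + n * (2 * Real.pi), ?_⟩
      rw [eventually_map]
      filter_upwards [eventually_ge_atTop T] with t ht
      have := hT n (by push_cast; linarith) t ht
      push_cast at this
      linarith
    have hdown : IsBoundedUnder (· ≥ ·) atTop θ := by
      obtain ⟨T, hT⟩ := (hbarrier 1 cp (by linarith)).exists
      obtain ⟨n, hn⟩ := exists_nat_gt ((cp - θ T) / (2 * Real.pi))
      rw [div_lt_iff₀ hP] at hn
      refine ⟨cp + (-(n : ℤ) : ℤ) * (2 * Real.pi), ?_⟩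
      rw [eventually_map]
      filter_upwards [eventually_ge_atTop T] with t ht
      have := hT (-n) (by push_cast; linarith) t ht
      linarith
    have hdense : Dense {c | deriv κ c ≠ 0} := by
      rw [dense_iff_inter_open]
      intro U hU ⟨c, hc⟩
      by_contra hemp
      rw [Set.not_nonempty_iff_eq_empty, Set.eq_empty_iff_forall_notMem] at hemp
      have hev : deriv κ =ᶠ[𝓝 c] 0 := by
        filter_upwards [hU.mem_nhds hc] with y hy
        by_contra h
        exact hemp y ⟨hy, h⟩
      have han : AnalyticOnNhd ℝ (deriv κ) Set.univ := fun y _ => (hκ y).deriv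
      have := han.eqOn_zero_of_preconnected_of_eventuallyEq_zero isPreconnected_univ
        (Set.mem_univ c) hev (Set.mem_univ cp)
      exact hcp.ne' this
    -- Being frequently below `a` and frequently above `b > a` would require crossing the level `a`
    -- in both directions at late times.
    refine tendsto_of_no_upcrossings hdense ?_ hup hdown
    rintro a ha b _ hab ⟨h1, h2⟩
    rcases lt_or_gt_of_ne (show deriv κ a ≠ 0 from ha) with hlt | hgt
    · obtain ⟨T, hT1, hT2⟩ := (h1.and_eventually (hbarrier (-1) a (by linarith))).exists
      have h3 := hT2 0 (by push_cast; linarith)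
      obtain ⟨t, ht1, ht2⟩ := (h2.and_eventually (eventually_ge_atTop T)).exists
      have := h3 t ht2
      push_cast at this
      linarith
    · obtain ⟨T, hT1, hT2⟩ := (h2.and_eventually (hbarrier 1 a (by linarith))).exists
      have h3 := hT2 0 (by push_cast; linarith)
      obtain ⟨t, ht1, ht2⟩ := (h1.and_eventually (eventually_ge_atTop T)).exists
      have := h3 t ht2
      push_cast at this
      linarith

end Crossing

/-! ### Trajectories against Puiseux arcs. -/

section Crossing

/-- Derivative of the `N`-th root of a positive function. -/
theorem hasDerivAt_rpow_inv_natCast {r : ℝ → ℝ} {r' t : ℝ} {N : ℕ} (hN : N ≠ 0) (hr : 0 < r t)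
    (h : HasDerivAt r r' t) :
    HasDerivAt (fun t => r t ^ (N : ℝ)⁻¹) (r' / (N * (r t ^ (N : ℝ)⁻¹) ^ (N - 1))) t := by
  have h1 := h.rpow_const (p := (N : ℝ)⁻¹) (Or.inl hr.ne')
  have hσ : 0 < r t ^ (N : ℝ)⁻¹ := Real.rpow_pos_of_pos hr _
  convert! h1 using 1
  rw [Real.rpow_sub_one hr.ne']
  have h2 : (r t ^ (N : ℝ)⁻¹) ^ (N - 1) * r t ^ (N : ℝ)⁻¹ = r t := by
    rw [← pow_succ, Nat.sub_add_cancel (Nat.one_le_iff_ne_zero.2 hN),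
      Real.rpow_inv_natCast_pow hr.le hN]
  have hN' : (N : ℝ) ≠ 0 := Nat.cast_ne_zero.2 hN
  rw [div_eq_iff (by positivity)]
  generalize r t ^ (N : ℝ)⁻¹ = σ at *
  field_simp
  rw [← h2]
  ring

/-- A trajectory of a field which is analytic in polar coordinates either stays on a given Puiseux
arc or leaves it for good. -/
theorem eventually_eq_or_eventually_ne_arc {a b : ℝ × ℝ → ℝ} {θ₀ : ℝ}
    (ha : AnalyticAt ℝ a (0, θ₀)) (hb : AnalyticAt ℝ b (0, θ₀)) {r θ : ℝ → ℝ}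
    (hr : ∀ᶠ t in atTop, 0 < r t) (hr0 : Tendsto r atTop (𝓝 0)) (hθ0 : Tendsto θ atTop (𝓝 θ₀))
    (hr' : ∀ᶠ t in atTop, HasDerivAt r (a (r t, θ t)) t)
    (hθ' : ∀ᶠ t in atTop, HasDerivAt θ (b (r t, θ t) / r t ^ 2) t)
    {N : ℕ} (hN : N ≠ 0) {φ : ℝ → ℝ} (hφ : AnalyticAt ℝ φ 0) :
    (∀ᶠ t in atTop, θ t = φ (r t ^ (N : ℝ)⁻¹)) ∨ ∀ᶠ t in atTop, θ t ≠ φ (r t ^ (N : ℝ)⁻¹) := by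
  set σ : ℝ → ℝ := fun t => r t ^ (N : ℝ)⁻¹ with hσdef
  have hσ0 : Tendsto σ atTop (𝓝 0) := by
    have hN' : (0 : ℝ) < (N : ℝ)⁻¹ := by positivity
    have := hr0.rpow_const (p := (N : ℝ)⁻¹) (Or.inr hN'.le)
    rwa [Real.zero_rpow hN'.ne'] at this
  have hσ : ∀ᶠ t in atTop, 0 < σ t := hr.mono fun t ht => Real.rpow_pos_of_pos ht _
  have hσr : ∀ᶠ t in atTop, σ t ^ N = r t :=
    hr.mono fun t ht => Real.rpow_inv_natCast_pow ht.le hN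
  have hφσ : Tendsto (fun t => φ (σ t)) atTop (𝓝 (φ 0)) := hφ.continuousAt.tendsto.comp hσ0
  by_cases hφ0 : φ 0 = θ₀
  swap
  · right
    have h1 := (hφσ.sub hθ0).eventually_ne (sub_ne_zero.2 hφ0)
    exact h1.mono fun t ht h => ht (by rw [h, sub_self])
  let E : ℝ → ℝ → ℝ := fun s w =>
    b (s ^ N, w) / (s ^ N) ^ 2 - deriv φ s * (a (s ^ N, w) / (N * s ^ (N - 1)))
  have hD : ∀ᶠ t in atTop, HasDerivAt (fun t => θ t - φ (σ t)) (E (σ t) (θ t)) t := by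
    filter_upwards [hr, hσr, hr', hθ', hσ0.eventually hφ.eventually_analyticAt]
      with t h1 h2 h3 h4 h5
    have h6 := h5.differentiableAt.hasDerivAt.comp t (hasDerivAt_rpow_inv_natCast hN h1 h3)
    have h7 := h4.sub h6
    simp only [E, h2]
    exact h7
  -- The speed relative to the arc, cleared of its positive denominators: an analytic function of
  -- `s` alone that decides whether the arc is invariant.
  let Q : ℝ → ℝ := fun s =>
    N * s ^ (N - 1) * b (s ^ N, φ s) - (s ^ N) ^ 2 * deriv φ s * a (s ^ N, φ s)
  have hcurve : AnalyticAt ℝ (fun s : ℝ => (s ^ N, φ s)) 0 := by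
    refine AnalyticAt.prod ?_ hφ
    fun_prop
  have hcurve0 : ((0 : ℝ) ^ N, φ 0) = (0, θ₀) := by rw [zero_pow hN, hφ0]
  have hQ : AnalyticAt ℝ Q 0 := by
    have hb' : AnalyticAt ℝ (fun s => b (s ^ N, φ s)) 0 :=
      AnalyticAt.fun_comp (g := b) (f := fun s : ℝ => (s ^ N, φ s)) (by rwa [hcurve0]) hcurve
    have ha' : AnalyticAt ℝ (fun s => a (s ^ N, φ s)) 0 :=
      AnalyticAt.fun_comp (g := a) (f := fun s : ℝ => (s ^ N, φ s)) (by rwa [hcurve0]) hcurve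
    refine AnalyticAt.sub (AnalyticAt.mul (by fun_prop) hb') (AnalyticAt.mul ?_ ha')
    exact AnalyticAt.mul (by fun_prop) hφ.deriv
  have hEQ : ∀ s, 0 < s → E s (φ s) = Q s / (N * s ^ (N - 1) * (s ^ N) ^ 2) := by
    intro s hs
    have hN' : (N : ℝ) ≠ 0 := Nat.cast_ne_zero.2 hN
    simp only [E, Q]
    field_simp
  by_cases hQ0 : ∀ᶠ s in 𝓝 0, Q s = 0
  · obtain ⟨Ka, Ua, hUa, hLa⟩ := (ha.contDiffAt (n := 1)).exists_lipschitzOnWith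
    obtain ⟨Kb, Ub, hUb, hLb⟩ := (hb.contDiffAt (n := 1)).exists_lipschitzOnWith
    have hU := inter_mem hUa hUb
    have hin1 : ∀ᶠ t in atTop, (r t, θ t) ∈ Ua ∩ Ub := (hr0.prodMk_nhds hθ0).eventually hU
    have hin2 : ∀ᶠ t in atTop, (r t, φ (σ t)) ∈ Ua ∩ Ub := by
      rw [hφ0] at hφσ
      exact (hr0.prodMk_nhds hφσ).eventually hU
    obtain ⟨T, hT⟩ := eventually_atTop.1 (hD.and (hin1.and (hin2.and (hσ.and (hσr.and
      ((hσ0.eventually hQ0).and ((hσ0.eventually hφ.eventually_analyticAt).and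
        (hr.and hr'))))))))
    by_cases hz : ∃ t₁ ≥ T, θ t₁ - φ (σ t₁) = 0
    · left
      obtain ⟨t₁, ht₁, hz⟩ := hz
      -- A Lipschitz factor for `E (σ t) ·`. It need not be bounded as `σ t → 0`; a bound on each
      -- `[t₁, t₂]` is enough for Grönwall uniqueness.
      let κ : ℝ → ℝ := fun t =>
        Kb / (σ t ^ N) ^ 2 + |deriv φ (σ t)| * (Ka / (N * σ t ^ (N - 1)))
      have hσc : ContinuousOn σ (Set.Ici T) := fun t ht => by
        have h := hT t ht
        exact (hasDerivAt_rpow_inv_natCast hN h.2.2.2.2.2.2.2.1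
          h.2.2.2.2.2.2.2.2).continuousAt.continuousWithinAt
      have hκc : ContinuousOn κ (Set.Ici T) := by
        have hφ' : ContinuousOn (fun t => deriv φ (σ t)) (Set.Ici T) := fun t ht =>
          (hT t ht).2.2.2.2.2.2.1.deriv.continuousAt.comp_continuousWithinAt (hσc t ht)
        have hpos : ∀ t ∈ Set.Ici T, 0 < σ t := fun t ht => (hT t ht).2.2.2.1
        have hN' : (N : ℝ) ≠ 0 := Nat.cast_ne_zero.2 hN
        refine ContinuousOn.add (continuousOn_const.div ((hσc.pow N).pow 2) ?_)
          (hφ'.abs.mul (continuousOn_const.div (continuousOn_const.mul (hσc.pow (N - 1))) ?_))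
        · intro t ht
          have := hpos t ht
          positivity
        · intro t ht
          have := hpos t ht
          positivity
      filter_upwards [eventually_ge_atTop t₁] with t₂ ht₂
      obtain ⟨K, hK⟩ := (isCompact_Icc (a := t₁) (b := t₂)).exists_bound_of_continuousOn
        (hκc.mono fun t ht => ht₁.trans ht.1)
      refine sub_eq_zero.1 (eq_zero_of_abs_deriv_le_mul_abs_self_of_eq_zero_right
        (f := fun t => θ t - φ (σ t)) (f' := fun t => E (σ t) (θ t)) (K := K)
        (fun t ht => (hT t (ht₁.trans ht.1)).1.continuousAt.continuousWithinAt)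
        (fun t ht => (hT t (ht₁.trans ht.1)).1.hasDerivWithinAt) hz ?_ t₂
        (Set.right_mem_Icc.2 ht₂))
      intro t ht
      obtain ⟨-, h1, h2, h3, h4, h5, -, h6, -⟩ := hT t (ht₁.trans ht.1)
      have hE0 : E (σ t) (φ (σ t)) = 0 := by rw [hEQ _ h3, h5, zero_div]
      have hda := hLa.dist_le_mul _ h1.1 _ h2.1
      have hdb := hLb.dist_le_mul _ h1.2 _ h2.2
      have hdist : dist (r t, θ t) (r t, φ (σ t)) = |θ t - φ (σ t)| := by
        rw [Prod.dist_eq, dist_self, Real.dist_eq, max_eq_right (abs_nonneg _)]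
      rw [hdist, Real.dist_eq] at hda hdb
      have hdiff : E (σ t) (θ t) = (b (r t, θ t) - b (r t, φ (σ t))) / (σ t ^ N) ^ 2
          - deriv φ (σ t) * ((a (r t, θ t) - a (r t, φ (σ t))) / (N * σ t ^ (N - 1))) := by
        rw [← sub_zero (E (σ t) (θ t)), ← hE0]
        simp only [E, h4]
        ring
      have hκK : κ t ≤ K := (le_abs_self _).trans (hK t ⟨ht.1, ht.2.le⟩)
      rw [Real.norm_eq_abs, Real.norm_eq_abs, hdiff]
      calc _ ≤ |(b (r t, θ t) - b (r t, φ (σ t))) / (σ t ^ N) ^ 2|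
            + |deriv φ (σ t) * ((a (r t, θ t) - a (r t, φ (σ t))) / (N * σ t ^ (N - 1)))| :=
          abs_sub _ _
        _ = |b (r t, θ t) - b (r t, φ (σ t))| / (σ t ^ N) ^ 2
            + |deriv φ (σ t)| * (|a (r t, θ t) - a (r t, φ (σ t))| / (N * σ t ^ (N - 1))) := by
          rw [abs_div, abs_mul, abs_div, abs_of_pos (show 0 < (σ t ^ N) ^ 2 by positivity),
            abs_of_nonneg (show 0 ≤ (N : ℝ) * σ t ^ (N - 1) by positivity)]
        _ ≤ (Kb * |θ t - φ (σ t)|) / (σ t ^ N) ^ 2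
            + |deriv φ (σ t)| * ((Ka * |θ t - φ (σ t)|) / (N * σ t ^ (N - 1))) := by
          gcongr
        _ = κ t * |θ t - φ (σ t)| := by simp only [κ]; ring
        _ ≤ K * |θ t - φ (σ t)| := by gcongr
    · right
      push Not at hz
      exact eventually_atTop.2 ⟨T, fun t ht h => hz t ht (sub_eq_zero.2 h)⟩
  · right
    -- Near `0⁺` the sign of `Q` is that of `q 0`, so multiplying by `q 0` makes every late crossing
    -- increasing.
    obtain ⟨n, q, hq, hq0, hQq⟩ := (hQ.exists_eventuallyEq_pow_smul_nonzero_iff).2 hQ0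
    simp only [sub_zero, smul_eq_mul] at hQq
    have hqq : ∀ᶠ s in 𝓝 0, 0 < q 0 * q s := by
      have h1 : ContinuousAt (fun s => q 0 * q s) 0 := continuousAt_const.mul hq.continuousAt
      exact h1.eventually (lt_mem_nhds (mul_self_pos.2 hq0))
    have hsign : ∀ᶠ t in atTop, q 0 * (θ t - φ (σ t)) = 0 → 0 < q 0 * E (σ t) (θ t) := by
      filter_upwards [hσ, hσ0.eventually hQq, hσ0.eventually hqq] with t h1 h2 h3 h4
      have h5 : θ t = φ (σ t) := sub_eq_zero.1 ((mul_eq_zero.1 h4).resolve_left hq0)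
      have hN' : (0 : ℝ) < N := by positivity
      rw [h5, hEQ _ h1, h2]
      have : q 0 * (σ t ^ n * q (σ t) / (N * σ t ^ (N - 1) * (σ t ^ N) ^ 2))
          = σ t ^ n / (N * σ t ^ (N - 1) * (σ t ^ N) ^ 2) * (q 0 * q (σ t)) := by ring
      rw [this]
      exact mul_pos (by positivity) h3
    have := eventually_ne_zero_of_deriv_pos (hD.mono fun t ht => ht.const_mul (q 0)) hsign
    exact this.mono fun t ht h => ht (by rw [h, sub_self, mul_zero])

/-- An analytic function of polar coordinates is eventually zero or eventually nonzero along a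
trajectory with a limit direction. -/
theorem eventually_eq_zero_or_ne_zero_of_polar {a b g : ℝ × ℝ → ℝ}
    {θ₀ : ℝ} (ha : AnalyticAt ℝ a (0, θ₀)) (hb : AnalyticAt ℝ b (0, θ₀))
    (hg : ∀ c, AnalyticAt ℝ g (0, c)) {r θ : ℝ → ℝ}
    (hr : ∀ᶠ t in atTop, 0 < r t) (hr0 : Tendsto r atTop (𝓝 0)) (hθ0 : Tendsto θ atTop (𝓝 θ₀))
    (hr' : ∀ᶠ t in atTop, HasDerivAt r (a (r t, θ t)) t)
    (hθ' : ∀ᶠ t in atTop, HasDerivAt θ (b (r t, θ t) / r t ^ 2) t) :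
    (∀ᶠ t in atTop, g (r t, θ t) = 0) ∨ ∀ᶠ t in atTop, g (r t, θ t) ≠ 0 := by
  have hlim : Tendsto (fun t => (r t, θ t)) atTop (𝓝 (0, θ₀)) := hr0.prodMk_nhds hθ0
  by_cases hz : ∀ᶠ q in 𝓝 (0, θ₀), g q = 0
  · exact Or.inl (hlim.eventually hz)
  obtain ⟨k, G, hG, hgG, c, hc⟩ := exists_eq_fst_pow_mul hg hz
  have hline : ∀ c, AnalyticAt ℝ (fun w => G (0, w)) c := fun c =>
    AnalyticAt.fun_comp (g := G) (f := fun c : ℝ => ((0 : ℝ), c)) (hG c) (by fun_prop)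
  have hord : analyticOrderAt (fun w => G (0, w)) θ₀ ≠ ⊤ := by
    rw [Ne, analyticOrderAt_eq_top]
    intro h
    have han : AnalyticOnNhd ℝ (fun w => G (0, w)) Set.univ := fun y _ => hline y
    exact hc (han.eqOn_zero_of_preconnected_of_eventuallyEq_zero isPreconnected_univ
      (Set.mem_univ θ₀) h (Set.mem_univ c))
  obtain ⟨n, hn⟩ := ENat.ne_top_iff_exists.1 hord
  obtain ⟨U, hU, S, hSfin, hS, hcov⟩ := exists_puiseuxCovered n G θ₀ (hG θ₀)
    ⟨n, le_rfl, ((analyticOrderAt_eq_nat_iff_iteratedDeriv_eq_zero (hline θ₀)).1 hn.symm).2⟩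
  -- On an invariant arc `g` becomes an analytic function of `r ^ (1/N)`; otherwise all the arcs,
  -- and with them the zeros of `G`, are eventually avoided.
  by_cases hinv : ∃ s ∈ S, ∀ᶠ t in atTop, θ t = s.2 (r t ^ (s.1 : ℝ)⁻¹)
  · obtain ⟨⟨N, φ⟩, hs, hinv⟩ := hinv
    obtain ⟨hN, hφ⟩ := hS _ hs
    dsimp only at hN hφ hinv
    have hN' : (0 : ℝ) < (N : ℝ)⁻¹ := by positivity
    have hσ0 : Tendsto (fun t => r t ^ (N : ℝ)⁻¹) atTop (𝓝 0) := by
      have := hr0.rpow_const (p := (N : ℝ)⁻¹) (Or.inr hN'.le)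
      rwa [Real.zero_rpow hN'.ne'] at this
    have hσ0' : Tendsto (fun t => r t ^ (N : ℝ)⁻¹) atTop (𝓝[≠] 0) :=
      tendsto_nhdsWithin_iff.2 ⟨hσ0, hr.mono fun t ht => (Real.rpow_pos_of_pos ht _).ne'⟩
    have hφ0 : φ 0 = θ₀ := by
      refine tendsto_nhds_unique (hφ.continuousAt.tendsto.comp hσ0) (hθ0.congr' ?_)
      exact hinv
    have hgφ : AnalyticAt ℝ (fun s => g (s ^ N, φ s)) 0 := by
      refine AnalyticAt.fun_comp (g := g) (f := fun s : ℝ => (s ^ N, φ s)) ?_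
        (AnalyticAt.prod (by fun_prop) hφ)
      rw [zero_pow hN]
      exact hg _
    have heq : ∀ᶠ t in atTop, g ((r t ^ (N : ℝ)⁻¹) ^ N, φ (r t ^ (N : ℝ)⁻¹)) = g (r t, θ t) := by
      filter_upwards [hinv, hr] with t h1 h2
      rw [← h1, Real.rpow_inv_natCast_pow h2.le hN]
    rcases hgφ.eventually_eq_zero_or_eventually_ne_zero with h | h
    · exact Or.inl ((heq.and (hσ0.eventually h)).mono fun t ht => ht.1 ▸ ht.2)
    · exact Or.inr ((heq.and (hσ0'.eventually h)).mono fun t ht => ht.1 ▸ ht.2)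
  · right
    have hne : ∀ s ∈ S, ∀ᶠ t in atTop, θ t ≠ s.2 (r t ^ (s.1 : ℝ)⁻¹) := fun s hs =>
      (eventually_eq_or_eventually_ne_arc ha hb hr hr0 hθ0 hr' hθ' (hS s hs).1
        (hS s hs).2).resolve_left fun h => hinv ⟨s, hs, h⟩
    have hall : ∀ᶠ t in atTop, ∀ s ∈ S, θ t ≠ s.2 (r t ^ (s.1 : ℝ)⁻¹) :=
      (Filter.eventually_all_finite hSfin).2 hne
    filter_upwards [hall, hr, hlim.eventually hU] with t h1 h2 h3 h4
    rw [hgG, mul_eq_zero] at h4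
    obtain ⟨s, hs, σ, hσ, heq⟩ := hcov (r t, θ t)
      ⟨h3, h2, h4.resolve_left (pow_ne_zero _ h2.ne')⟩
    rw [Prod.mk.injEq] at heq
    refine h1 s hs ?_
    rw [heq.1, Real.pow_rpow_inv_natCast hσ.le (hS s hs).1]
    exact heq.2

end Crossing

/-! ### Polar coordinates along a gradient trajectory. -/

section Polar

theorem hasDerivAt_euclidean {ι : Type*} [Fintype ι] {x : ℝ → EuclideanSpace ℝ ι}
    {x' : EuclideanSpace ℝ ι} {t : ℝ} :
    HasDerivAt x x' t ↔ ∀ i, HasDerivAt (fun t => x t i) (x' i) t := by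
  constructor
  · intro h i
    exact (EuclideanSpace.proj (𝕜 := ℝ) i).hasFDerivAt.comp_hasDerivAt t h
  · intro h
    have h1 : HasDerivAt (fun t i => x t i) (fun i => x' i) t := hasDerivAt_pi.2 h
    exact (EuclideanSpace.equiv ι ℝ).symm.toContinuousLinearMap.hasFDerivAt.comp_hasDerivAt t h1

/-- A nowhere vanishing differentiable curve in `ℂ` has a differentiable logarithm. -/
theorem exists_log_lift {z v : ℝ → ℂ} {T : ℝ} (hz : ∀ t ≥ T, HasDerivAt z (v t) t)
    (hv : ContinuousOn v (Set.Ici T)) (h0 : ∀ t ≥ T, z t ≠ 0) :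
    ∃ L : ℝ → ℂ, ∀ t ≥ T, HasDerivAt L (v t / z t) t ∧ Complex.exp (L t) = z t := by
  have hzc : ContinuousOn z (Set.Ici T) := fun t ht =>
    (hz t ht).continuousAt.continuousWithinAt
  have hw : Continuous fun s => v (max T s) / z (max T s) :=
    (hv.div hzc h0).comp_continuous (by fun_prop) fun s => le_max_left T s
  -- A primitive of `z' / z`; `max T s` freezes the integrand before `T` and keeps it continuous on
  -- all of `ℝ`.
  let L : ℝ → ℂ := fun t => Complex.log (z T) + ∫ s in T..t, v (max T s) / z (max T s)
  have hL : ∀ t ≥ T, HasDerivAt L (v t / z t) t := by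
    intro t ht
    have h1 := (hw.integral_hasStrictDerivAt T t).hasDerivAt.const_add (Complex.log (z T))
    simpa only [max_eq_right ht] using h1
  refine ⟨L, fun t ht => ⟨hL t ht, ?_⟩⟩
  have hder : ∀ s ≥ T, HasDerivAt (fun s => z s * Complex.exp (-L s)) 0 s := by
    intro s hs
    convert! (hz s hs).mul (hL s hs).neg.cexp using 1
    have := h0 s hs
    field_simp
    ring
  have hconst := constant_of_has_deriv_right_zero (a := T) (b := t)
    (f := fun s => z s * Complex.exp (-L s))
    (fun s hs => (hder s hs.1).continuousAt.continuousWithinAt)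
    (fun s hs => (hder s hs.1).hasDerivWithinAt) t (Set.right_mem_Icc.2 ht)
  have hT : z T * Complex.exp (-L T) = 1 := by
    have : L T = Complex.log (z T) := by simp [L]
    rw [this, Complex.exp_neg, Complex.exp_log (h0 T le_rfl), mul_inv_cancel₀ (h0 T le_rfl)]
  rw [hT, Complex.exp_neg, mul_inv_eq_one₀ (Complex.exp_ne_zero _)] at hconst
  exact hconst.symm

/-- The point with polar coordinates `q`. -/
noncomputable def polarPoint (q : ℝ × ℝ) : EuclideanSpace ℝ (Fin 2) :=
  !₂[q.1 * Real.cos q.2, q.1 * Real.sin q.2]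

theorem polarPoint_eq (q : ℝ × ℝ) : polarPoint q =
    (q.1 * Real.cos q.2) • !₂[(1 : ℝ), 0] + (q.1 * Real.sin q.2) • !₂[(0 : ℝ), 1] := by
  ext i
  fin_cases i <;> simp [polarPoint]

theorem polarPoint_zero (c : ℝ) : polarPoint (0, c) = 0 := by
  ext i
  fin_cases i <;> simp [polarPoint]

theorem analyticAt_polarPoint (q : ℝ × ℝ) : AnalyticAt ℝ polarPoint q := by
  have h : polarPoint = fun q : ℝ × ℝ =>
      (q.1 * Real.cos q.2) • !₂[(1 : ℝ), 0] + (q.1 * Real.sin q.2) • !₂[(0 : ℝ), 1] :=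
    funext polarPoint_eq
  rw [h]
  have hc : AnalyticAt ℝ (fun q : ℝ × ℝ => Real.cos q.2) q :=
    Real.analyticAt_cos.fun_comp analyticAt_snd
  have hs : AnalyticAt ℝ (fun q : ℝ × ℝ => Real.sin q.2) q :=
    Real.analyticAt_sin.fun_comp analyticAt_snd
  exact ((analyticAt_fst.mul hc).smul analyticAt_const).add
    ((analyticAt_fst.mul hs).smul analyticAt_const)

theorem AnalyticAt.comp_polarPoint {f : EuclideanSpace ℝ (Fin 2) → ℝ} (hf : AnalyticAt ℝ f 0)
    (c : ℝ) : AnalyticAt ℝ (fun q => f (polarPoint q)) (0, c) :=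
  AnalyticAt.fun_comp (g := f) (f := polarPoint) (by rwa [polarPoint_zero])
    (analyticAt_polarPoint _)

theorem hasDerivAt_comp_polarPoint_fst {f : EuclideanSpace ℝ (Fin 2) → ℝ} {r c : ℝ}
    (hf : DifferentiableAt ℝ f (polarPoint (r, c))) :
    HasDerivAt (fun s => f (polarPoint (s, c)))
      (gradient f (polarPoint (r, c)) 0 * Real.cos c
        + gradient f (polarPoint (r, c)) 1 * Real.sin c) r := by
  have h1 : HasDerivAt (fun s => polarPoint (s, c)) !₂[Real.cos c, Real.sin c] r := by
    rw [hasDerivAt_euclidean]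
    intro i
    fin_cases i
    · simpa [polarPoint] using (hasDerivAt_id r).mul_const (Real.cos c)
    · simpa [polarPoint] using (hasDerivAt_id r).mul_const (Real.sin c)
  have h2 := HasFDerivAt.comp_hasDerivAt (l := f) r hf.hasGradientAt.hasFDerivAt h1
  convert! h2 using 1
  rw [InnerProductSpace.toDual_apply_apply, PiLp.inner_apply, Fin.sum_univ_two]
  simp [mul_comm]

/-- The factor `r` here, and a second one relating tangential to angular speed, account for `r²` in
the equation for `θ`. -/
theorem hasDerivAt_comp_polarPoint_snd {f : EuclideanSpace ℝ (Fin 2) → ℝ} {r c : ℝ}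
    (hf : DifferentiableAt ℝ f (polarPoint (r, c))) :
    HasDerivAt (fun s => f (polarPoint (r, s)))
      (r * (gradient f (polarPoint (r, c)) 1 * Real.cos c
        - gradient f (polarPoint (r, c)) 0 * Real.sin c)) c := by
  have h1 : HasDerivAt (fun s => polarPoint (r, s)) !₂[r * -Real.sin c, r * Real.cos c] c := by
    rw [hasDerivAt_euclidean]
    intro i
    fin_cases i
    · simpa [polarPoint] using (Real.hasDerivAt_cos c).const_mul r
    · simpa [polarPoint] using (Real.hasDerivAt_sin c).const_mul r
  have h2 := HasFDerivAt.comp_hasDerivAt (l := f) c hf.hasGradientAt.hasFDerivAt h1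
  convert! h2 using 1
  rw [InnerProductSpace.toDual_apply_apply, PiLp.inner_apply, Fin.sum_univ_two]
  simp
  ring

theorem AnalyticAt.gradient {E : Type*} [NormedAddCommGroup E] [InnerProductSpace ℝ E]
    [CompleteSpace E] {f : E → ℝ} {p : E} (hf : AnalyticAt ℝ f p) :
    AnalyticAt ℝ (gradient f) p :=
  ((InnerProductSpace.toDual ℝ E).symm.toContinuousLinearEquiv.toContinuousLinearMap.analyticAt
    _).fun_comp hf.fderiv

/-- Polar coordinates along a gradient trajectory which avoids the origin. -/
theorem exists_polar_lift {f : EuclideanSpace ℝ (Fin 2) → ℝ} {x : ℝ → EuclideanSpace ℝ (Fin 2)}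
    (hf : ∀ᶠ t in atTop, AnalyticAt ℝ f (x t))
    (hx : ∀ᶠ t in atTop, HasDerivAt x (gradient f (x t)) t) (h0 : ∀ᶠ t in atTop, x t ≠ 0) :
    ∃ r θ : ℝ → ℝ, ∀ᶠ t in atTop, 0 < r t ∧ x t = polarPoint (r t, θ t) ∧
      HasDerivAt r (deriv (fun s => f (polarPoint (s, θ t))) (r t)) t ∧
      HasDerivAt θ (deriv (fun c => f (polarPoint (r t, c))) (θ t) / r t ^ 2) t := by
  obtain ⟨T, hT⟩ := eventually_atTop.1 (hf.and (hx.and h0))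
  have hcoord : ∀ t ≥ T, ∀ i, HasDerivAt (fun t => x t i) (gradient f (x t) i) t := fun t ht =>
    hasDerivAt_euclidean.1 (hT t ht).2.1
  have hgc : ∀ i, ContinuousOn (fun t => gradient f (x t) i) (Set.Ici T) := by
    intro i t ht
    have h1 : ContinuousAt (fun t => gradient f (x t)) t :=
      ContinuousAt.comp (g := gradient f) (hT t ht).1.gradient.continuousAt
        (hT t ht).2.1.continuousAt
    exact ((EuclideanSpace.proj (𝕜 := ℝ) i).continuous.continuousAt.comp
      h1).continuousWithinAt
  obtain ⟨L, hL⟩ := exists_log_lift (T := T)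
    (z := fun t => (x t 0 : ℂ) + (x t 1 : ℂ) * Complex.I)
    (v := fun t => (gradient f (x t) 0 : ℂ) + (gradient f (x t) 1 : ℂ) * Complex.I)
    (fun t ht => (hcoord t ht 0).ofReal_comp.add ((hcoord t ht 1).ofReal_comp.mul_const _))
    ((Complex.continuous_ofReal.comp_continuousOn (hgc 0)).add
      ((Complex.continuous_ofReal.comp_continuousOn (hgc 1)).mul continuousOn_const))
    (fun t ht h => (hT t ht).2.2 (by
      ext i
      have h1 := congrArg Complex.re h
      have h2 := congrArg Complex.im h
      simp at h1 h2
      fin_cases i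
      exacts [h1, h2]))
  refine ⟨fun t => Real.exp (L t).re, fun t => (L t).im, ?_⟩
  filter_upwards [eventually_ge_atTop T] with t ht
  obtain ⟨hL', hexp⟩ := hL t ht
  set r := Real.exp (L t).re with hr
  set θ := (L t).im
  have hrpos : 0 < r := Real.exp_pos _
  have hx0 : r * Real.cos θ = x t 0 := by
    have := congrArg Complex.re hexp
    simpa [Complex.exp_re] using this
  have hx1 : r * Real.sin θ = x t 1 := by
    have := congrArg Complex.im hexp
    simpa [Complex.exp_im] using this
  have hxp : x t = polarPoint (r, θ) := by
    ext i
    fin_cases i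
    · simp [polarPoint, hx0]
    · simp [polarPoint, hx1]
  have hdf : DifferentiableAt ℝ f (polarPoint (r, θ)) := hxp ▸ (hT t ht).1.differentiableAt
  have hre := (Complex.reCLM.hasFDerivAt.comp_hasDerivAt t hL')
  have him := (Complex.imCLM.hasFDerivAt.comp_hasDerivAt t hL')
  have hns : x t 0 ^ 2 + x t 1 ^ 2 = r ^ 2 := by
    rw [← hx0, ← hx1]
    linear_combination r ^ 2 * Real.sin_sq_add_cos_sq θ
  refine ⟨hrpos, hxp, ?_, ?_⟩
  · rw [(hasDerivAt_comp_polarPoint_fst hdf).deriv, ← hxp]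
    convert! hre.exp using 1
    simp [Complex.div_re, Complex.normSq_apply, ← pow_two, hns]
    change _ = r * _
    rw [← hx0, ← hx1]
    field_simp
  · rw [(hasDerivAt_comp_polarPoint_snd hdf).deriv, ← hxp]
    convert! him using 1
    simp [Complex.div_im, Complex.normSq_apply, ← pow_two, hns]
    rw [← hx0, ← hx1]
    field_simp

theorem tendsto_fst_of_polarPoint {x : ℝ → EuclideanSpace ℝ (Fin 2)} {r θ : ℝ → ℝ}
    {l : Filter ℝ} (h : ∀ᶠ t in l, 0 < r t ∧ x t = polarPoint (r t, θ t))
    (hx : Tendsto x l (𝓝 0)) : Tendsto r l (𝓝 0) := by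
  refine (tendsto_norm_zero.comp hx).congr' ?_
  filter_upwards [h] with t ht
  rw [Function.comp_apply, ht.2, EuclideanSpace.norm_eq, Fin.sum_univ_two]
  simp only [polarPoint, Matrix.cons_val_zero, Matrix.cons_val_one, Real.norm_eq_abs, sq_abs]
  rw [show (r t * Real.cos (θ t)) ^ 2 + (r t * Real.sin (θ t)) ^ 2 = r t ^ 2 by
    linear_combination r t ^ 2 * Real.sin_sq_add_cos_sq (θ t)]
  exact Real.sqrt_sq ht.1.le

/-- A gradient trajectory which returns to a point rests there. -/
theorem eventually_eq_of_frequently_eq {E : Type*} [NormedAddCommGroup E] [InnerProductSpace ℝ E]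
    [CompleteSpace E] {f : E → ℝ} {x : ℝ → E} {p : E}
    (hf : ∀ᶠ t in atTop, DifferentiableAt ℝ f (x t))
    (hx : ∀ᶠ t in atTop, HasDerivAt x (gradient f (x t)) t) (hp : ∃ᶠ t in atTop, x t = p) :
    ∀ᶠ t in atTop, x t = p := by
  obtain ⟨T, hT⟩ := eventually_atTop.1 (hf.and hx)
  have hder : ∀ t ≥ T, HasDerivAt (fun t => f (x t)) (‖gradient f (x t)‖ ^ 2) t := by
    intro t ht
    have h := HasFDerivAt.comp_hasDerivAt (l := f) t (hT t ht).1.hasGradientAt.hasFDerivAt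
      (hT t ht).2
    convert! h using 1
    rw [InnerProductSpace.toDual_apply_apply, real_inner_self_eq_norm_sq]
  have hmono : MonotoneOn (fun t => f (x t)) (Set.Ici T) := by
    refine monotoneOn_of_deriv_nonneg (convex_Ici T)
      (fun t ht => (hder t ht).continuousAt.continuousWithinAt)
      (fun t ht => (hder t (interior_subset ht)).differentiableAt.differentiableWithinAt) ?_
    intro t ht
    rw [(hder t (interior_subset ht)).deriv]
    positivity
  obtain ⟨t₁, h1, ht₁⟩ := (hp.and_eventually (eventually_ge_atTop T)).exists
  filter_upwards [eventually_gt_atTop t₁] with t ht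
  obtain ⟨t₂, h2, ht₂⟩ := (hp.and_eventually (eventually_gt_atTop t)).exists
  -- Between two visits to `p` the monotone function `f ∘ x` is constant, so its derivative `‖∇f‖²`
  -- vanishes and the point does not move.
  have hconst : ∀ s ∈ Set.Icc t₁ t₂, f (x s) = f p := by
    intro s hs
    have hsT : T ≤ s := ht₁.trans hs.1
    have e1 := hmono (Set.mem_Ici.2 ht₁) (Set.mem_Ici.2 hsT) hs.1
    have e2 := hmono (Set.mem_Ici.2 hsT) (Set.mem_Ici.2 (hsT.trans hs.2)) hs.2
    simp only [h1, h2] at e1 e2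
    exact le_antisymm e2 e1
  have hgrad : ∀ s ∈ Set.Ico t₁ t₂, HasDerivWithinAt x 0 (Set.Ici s) s := by
    intro s hs
    have hsT : T ≤ s := ht₁.trans hs.1
    have h3 : HasDerivWithinAt (fun t => f (x t)) 0 (Set.Ici s) s := by
      refine (hasDerivWithinAt_const s (Set.Ici s) (f p)).congr_of_eventuallyEq ?_
        (hconst s (Set.Ico_subset_Icc_self hs))
      filter_upwards [Icc_mem_nhdsGE hs.2] with u hu
      exact hconst u ⟨hs.1.trans hu.1, hu.2⟩
    have h4 := (uniqueDiffWithinAt_Ici s).eq_deriv _ (hder s hsT).hasDerivWithinAt h3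
    have h5 : gradient f (x s) = 0 := by simpa using h4
    have h6 := (hT s hsT).2
    rw [h5] at h6
    exact h6.hasDerivWithinAt
  rw [← h1]
  exact constant_of_has_deriv_right_zero (a := t₁) (b := t₂)
    (fun s hs => (hT s (ht₁.trans hs.1)).2.continuousAt.continuousWithinAt) hgrad t
    ⟨ht.le, ht₂.le⟩

end Polar

/-! ### Non-oscillation with respect to analytic sets. -/

section Main

/-- An analytic function is eventually zero or eventually nonzero along a planar gradient
trajectory which tends to the origin in infinite time. -/
theorem eventually_eq_zero_or_ne_zero_of_gradient {f g : EuclideanSpace ℝ (Fin 2) → ℝ}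
    {x : ℝ → EuclideanSpace ℝ (Fin 2)} (hf : AnalyticAt ℝ f 0) (hg : AnalyticAt ℝ g 0)
    (hx : ∀ᶠ t in atTop, HasDerivAt x (gradient f (x t)) t) (hlim : Tendsto x atTop (𝓝 0)) :
    (∀ᶠ t in atTop, g (x t) = 0) ∨ ∀ᶠ t in atTop, g (x t) ≠ 0 := by
  have hfx : ∀ᶠ t in atTop, AnalyticAt ℝ f (x t) := hlim.eventually hf.eventually_analyticAt
  by_cases h0 : ∃ᶠ t in atTop, x t = 0
  · have hx0 := eventually_eq_of_frequently_eq (hfx.mono fun t ht => ht.differentiableAt) hx h0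
    by_cases hg0 : g 0 = 0
    · exact Or.inl (hx0.mono fun t ht => by rw [ht, hg0])
    · exact Or.inr (hx0.mono fun t ht => by rwa [ht])
  · rw [not_frequently] at h0
    obtain ⟨r, θ, h⟩ := exists_polar_lift hfx hx h0
    have hr0 : Tendsto r atTop (𝓝 0) :=
      tendsto_fst_of_polarPoint (h.mono fun t ht => ⟨ht.1, ht.2.1⟩) hlim
    have hF := hf.comp_polarPoint
    have hr : ∀ᶠ t in atTop, 0 < r t := h.mono fun t ht => ht.1
    obtain ⟨θ₀, hθ₀⟩ := exists_tendsto_angle hF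
      (fun r c => by simp [polarPoint]) hr hr0 (h.mono fun t ht => ht.2.2.2)
    have hFan : ∀ᶠ t in atTop, AnalyticAt ℝ (fun q => f (polarPoint q)) (r t, θ t) :=
      (hr0.prodMk_nhds hθ₀).eventually (hF θ₀).eventually_analyticAt
    have key := eventually_eq_zero_or_ne_zero_of_polar ((hF θ₀).fderiv_apply_const (1, 0))
      ((hF θ₀).fderiv_apply_const (0, 1)) hg.comp_polarPoint hr hr0 hθ₀
      ((h.and hFan).mono fun t ht => ht.2.hasDerivAt_fst.deriv ▸ ht.1.2.2.1)
      ((h.and hFan).mono fun t ht => ht.2.hasDerivAt_snd.deriv ▸ ht.1.2.2.2)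
    refine key.imp (fun hk => ?_) (fun hk => ?_)
    · exact (hk.and h).mono fun t ht => by rw [ht.2.2.1]; exact ht.1
    · exact (hk.and h).mono fun t ht => by rw [ht.2.2.1]; exact ht.1

/-- A curve along which analytic functions do not oscillate does not oscillate with respect to
analytic sets. -/
theorem IsAnalyticSubset.eventually_mem_or_notMem {E : Type*} [NormedAddCommGroup E]
    [NormedSpace ℝ E] {V Γ : Set E} (hΓ : IsAnalyticSubset V Γ) {p : E} (hp : p ∈ V) {x : ℝ → E}
    {l : Filter ℝ} (hx : Tendsto x l (𝓝 p))
    (h : ∀ g : E → ℝ, AnalyticAt ℝ g p → (∀ᶠ t in l, g (x t) = 0) ∨ ∀ᶠ t in l, g (x t) ≠ 0) :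
    (∀ᶠ t in l, x t ∈ Γ) ∨ ∀ᶠ t in l, x t ∉ Γ := by
  obtain ⟨W, hW, hpW, -, k, g, hg, hgΓ⟩ := hΓ.2 p hp
  have hxW : ∀ᶠ t in l, x t ∈ W := hx.eventually (hW.mem_nhds hpW)
  by_cases hall : ∀ i, ∀ᶠ t in l, g i (x t) = 0
  · left
    filter_upwards [hxW, eventually_all.2 hall] with t h1 h2
    exact (hgΓ _ h1).2 h2
  · right
    push Not at hall
    obtain ⟨i, hi⟩ := hall
    filter_upwards [hxW, (h (g i) (hg i p hpW)).resolve_left fun h' => by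
      obtain ⟨t, ht1, ht2⟩ := (hi.and_eventually h').exists
      exact ht1 ht2] with t h1 h2 h3
    exact h2 ((hgΓ _ h1).1 h3 i)

/-- The identity theorem for the one-variable functions `g i ∘ y`: one of them with isolated zeros
already keeps the curve out of `Γ`. -/
theorem IsAnalyticSubset.eventually_mem_or_notMem_of_analyticAt {E : Type*}
    [NormedAddCommGroup E] [NormedSpace ℝ E] {V Γ : Set E} (hΓ : IsAnalyticSubset V Γ)
    {y : ℝ → E} {t : ℝ} (hy : AnalyticAt ℝ y t) (hp : y t ∈ V) :
    (∀ᶠ s in 𝓝 t, y s ∈ Γ) ∨ ∀ᶠ s in 𝓝[≠] t, y s ∉ Γ := by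
  obtain ⟨W, hW, hpW, -, k, g, hg, hgΓ⟩ := hΓ.2 _ hp
  have hyW : ∀ᶠ s in 𝓝 t, y s ∈ W := hy.continuousAt.eventually (hW.mem_nhds hpW)
  have halt : ∀ i, (∀ᶠ s in 𝓝 t, g i (y s) = 0) ∨ ∀ᶠ s in 𝓝[≠] t, g i (y s) ≠ 0 := fun i =>
    (AnalyticAt.fun_comp (g := g i) (hg i _ hpW) hy).eventually_eq_zero_or_eventually_ne_zero
  by_cases hall : ∀ i, ∀ᶠ s in 𝓝 t, g i (y s) = 0
  · left
    filter_upwards [hyW, eventually_all.2 hall] with s h1 h2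
    exact (hgΓ _ h1).2 h2
  · right
    rw [not_forall] at hall
    obtain ⟨i, hi⟩ := hall
    filter_upwards [hyW.filter_mono nhdsWithin_le_nhds, (halt i).resolve_left hi] with s h1 h2 h3
    exact h2 ((hgΓ _ h1).1 h3 i)

/-- A solution of an analytic differential equation with a limit at the end of its interval of
definition extends analytically. -/
theorem exists_analyticAt_extension {E : Type*} [NormedAddCommGroup E] [NormedSpace ℝ E]
    [CompleteSpace E] {X : E → E} {p : E} (hX : AnalyticAt ℝ X p) {x : ℝ → E} {b : ℝ}
    (hx : ∀ᶠ t in 𝓝[<] b, HasDerivAt x (X (x t)) t) (hlim : Tendsto x (𝓝[<] b) (𝓝 p)) :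
    ∃ y : ℝ → E, AnalyticAt ℝ y b ∧ y b = p ∧ ∀ t < b, y t = x t := by
  classical
  -- A local solution starting from `p` at time `b` is glued to `x`. The left derivative at `b` is
  -- the limit of the derivatives, so the glued curve solves the equation across `b`.
  obtain ⟨α, hα0, ε, hε, hα⟩ :=
    (hX.contDiffAt (n := 1)).exists_forall_mem_closedBall_exists_eq_forall_mem_Ioo_hasDerivAt₀ b
  let y : ℝ → E := fun t => if t < b then x t else α t
  have hyx : ∀ t < b, y t = x t := fun t ht => if_pos ht
  have hyα : ∀ t ≥ b, y t = α t := fun t ht => if_neg (not_lt.2 ht)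
  have hyb : y b = p := (hyα b le_rfl).trans hα0
  obtain ⟨a, hab, ha⟩ := mem_nhdsLT_iff_exists_Ioo_subset.1 hx
  rw [Set.mem_Iio] at hab
  have hleft : ∀ t ∈ Set.Ioo a b, HasDerivAt y (X (y t)) t := by
    intro t ht
    rw [hyx t ht.2]
    refine (ha ht).congr_of_eventuallyEq ?_
    filter_upwards [gt_mem_nhds ht.2] with s hs
    exact hyx s hs
  have hright : ∀ t ∈ Set.Ioo b (b + ε), HasDerivAt y (X (y t)) t := by
    intro t ht
    rw [hyα t ht.1.le]
    refine (hα t ⟨by linarith [ht.1], ht.2⟩).congr_of_eventuallyEq ?_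
    filter_upwards [lt_mem_nhds ht.1] with s hs
    exact hyα s hs.le
  have hlim' : Tendsto y (𝓝[<] b) (𝓝 p) :=
    hlim.congr' (eventually_mem_nhdsWithin.mono fun t ht => (hyx t ht).symm)
  have hmid : HasDerivAt y (X (y b)) b := by
    have h1 : HasDerivWithinAt y (X (y b)) (Set.Iic b) b := by
      refine hasDerivWithinAt_Iic_of_tendsto_deriv (s := Set.Ioo a b)
        (fun t ht => (hleft t ht).differentiableAt.differentiableWithinAt) ?_
        (Ioo_mem_nhdsLT hab) ?_
      · have h2 : ContinuousWithinAt y (Set.Iio b) b := by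
          rw [ContinuousWithinAt, hyb]; exact hlim'
        exact h2.mono Set.Ioo_subset_Iio_self
      · rw [hyb]
        refine (hX.continuousAt.tendsto.comp hlim').congr' ?_
        filter_upwards [Ioo_mem_nhdsLT hab] with t ht
        exact (hleft t ht).deriv.symm
    have h2 : HasDerivWithinAt y (X (y b)) (Set.Ici b) b := by
      rw [hyα b le_rfl]
      exact (hα b ⟨by linarith, by linarith⟩).hasDerivWithinAt.congr (fun t ht => hyα t ht)
        (hyα b le_rfl)
    exact (h1.union h2).hasDerivAt (by simp)
  refine ⟨y, analyticAt_of_eventually_hasDerivAt (X := X) (by rwa [hyb]) ?_, hyb, hyx⟩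
  filter_upwards [Ioo_mem_nhds hab (lt_add_of_pos_right b hε)] with t ht
  rcases lt_trichotomy t b with h | rfl | h
  exacts [hleft t ⟨ht.1, h⟩, hmid, hright t ⟨h, ht.2⟩]

/-- The same as `exists_analyticAt_extension` for the beginning of the interval. -/
theorem exists_analyticAt_extension_left {E : Type*} [NormedAddCommGroup E] [NormedSpace ℝ E]
    [CompleteSpace E] {X : E → E} {p : E} (hX : AnalyticAt ℝ X p) {x : ℝ → E} {a : ℝ}
    (hx : ∀ᶠ t in 𝓝[>] a, HasDerivAt x (X (x t)) t) (hlim : Tendsto x (𝓝[>] a) (𝓝 p)) :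
    ∃ y : ℝ → E, AnalyticAt ℝ y a ∧ y a = p ∧ ∀ t > a, y t = x t := by
  have hneg : Tendsto (fun t : ℝ => -t) (𝓝[<] (-a)) (𝓝[>] a) := by
    simpa using tendsto_neg_nhdsLT (a := -a)
  obtain ⟨y, hy, hyp, hyx⟩ := exists_analyticAt_extension (X := fun z => -X z) hX.neg
    (x := fun t => x (-t)) (b := -a) (p := p) (by
      filter_upwards [hneg.eventually hx] with t ht
      have := ht.scomp t (hasDerivAt_neg t)
      rwa [neg_one_smul] at this) (hlim.comp hneg)
  refine ⟨fun t => y (-t), ?_, hyp, fun t ht => ?_⟩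
  · exact AnalyticAt.fun_comp (g := y) (f := fun t : ℝ => -t) hy (by fun_prop)
  · exact (hyx _ (neg_lt_neg ht)).trans (by rw [neg_neg])

theorem exists_real_gt_of_mem_timeInterval {β : EReal} {t : ℝ} (ht : t ∈ timeInterval β) :
    ∃ b : ℝ, t < b ∧ (b : EReal) < β := by
  obtain ⟨b, h1, h2⟩ := EReal.lt_iff_exists_real_btwn.1 ht.2
  exact ⟨b, EReal.coe_lt_coe_iff.1 h1, h2⟩

theorem ordConnected_timeInterval (β : EReal) : (timeInterval β).OrdConnected :=
  ⟨fun _ ha _ hb _ ht =>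
    ⟨ha.1.trans ht.1, (EReal.coe_le_coe_iff.2 ht.2).trans_lt hb.2⟩⟩

theorem IsGradientTrajectory.hasDerivAt {E : Type*} [NormedAddCommGroup E]
    [InnerProductSpace ℝ E] [CompleteSpace E] {U : Set E} {f : E → ℝ} {β : EReal} {x : ℝ → E}
    (hx : IsGradientTrajectory U f β x) {t : ℝ} (ht : t ∈ timeInterval β) (h0 : 0 < t) :
    HasDerivAt x (gradient f (x t)) t := by
  obtain ⟨b, htb, hb⟩ := exists_real_gt_of_mem_timeInterval ht
  refine (hx.deriv t ht).hasDerivAt ?_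
  filter_upwards [Ioo_mem_nhds h0 htb] with s hs
  exact ⟨hs.1.le, (EReal.coe_lt_coe_iff.2 hs.2).trans hb⟩

/-- Gradient trajectories of analytic functions are analytic, up to the initial point. -/
theorem IsGradientTrajectory.exists_analyticAt {E : Type*} [NormedAddCommGroup E]
    [InnerProductSpace ℝ E] [CompleteSpace E] {U : Set E} {f : E → ℝ} {β : EReal} {x : ℝ → E}
    (hx : IsGradientTrajectory U f β x) (hf : AnalyticOnNhd ℝ f U) {t : ℝ}
    (ht : t ∈ timeInterval β) :
    ∃ y : ℝ → E, AnalyticAt ℝ y t ∧ y t = x t ∧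
      ∀ᶠ s in 𝓝 t, s ∈ timeInterval β → y s = x s := by
  have hX : AnalyticAt ℝ (gradient f) (x t) := (hf _ (hx.mem t ht)).gradient
  obtain ⟨b, htb, hb⟩ := exists_real_gt_of_mem_timeInterval ht
  have hmem : ∀ s, 0 ≤ s → s < b → s ∈ timeInterval β := fun s h1 h2 =>
    ⟨h1, (EReal.coe_lt_coe_iff.2 h2).trans hb⟩
  rcases ht.1.eq_or_lt with rfl | h0
  -- At `t = 0` nothing is known about `x` to the left, so an analytic extension takes its place.
  · have hc : ContinuousWithinAt x (Set.Ioi 0) 0 := by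
      refine (hx.deriv 0 ht).continuousWithinAt.mono_of_mem_nhdsWithin ?_
      filter_upwards [Ioo_mem_nhdsGT htb] with s hs
      exact hmem s hs.1.le hs.2
    obtain ⟨y, hy, hy0, hyx⟩ := exists_analyticAt_extension_left hX (x := x) (a := 0) (by
      filter_upwards [Ioo_mem_nhdsGT htb] with s hs
      exact hx.hasDerivAt (hmem s hs.1.le hs.2) hs.1) hc
    refine ⟨y, hy, hy0, Eventually.of_forall fun s hs => ?_⟩
    rcases hs.1.eq_or_lt with rfl | h
    exacts [hy0, hyx s h]
  · refine ⟨x, analyticAt_of_eventually_hasDerivAt hX ?_, rfl, Eventually.of_forall fun _ _ => rfl⟩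
    filter_upwards [Ioo_mem_nhds h0 htb] with s hs
    exact hx.hasDerivAt (hmem s hs.1.le hs.2) hs.1

/-- Near its end a gradient trajectory tending to the origin does not oscillate with respect to an
analytic set. -/
theorem IsGradientTrajectory.exists_forall_mem_or_forall_notMem
    {U : Set (EuclideanSpace ℝ (Fin 2))} (h0U : 0 ∈ U)
    {f : EuclideanSpace ℝ (Fin 2) → ℝ} (hf : AnalyticOnNhd ℝ f U)
    {V Γ : Set (EuclideanSpace ℝ (Fin 2))} (h0V : 0 ∈ V) (hΓ : IsAnalyticSubset V Γ)
    {β : EReal} {x : ℝ → EuclideanSpace ℝ (Fin 2)} (hx : IsGradientTrajectory U f β x)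
    (hlim : Tendsto x (comap (fun t : ℝ => (t : EReal)) (𝓝[<] β)) (𝓝 0)) :
    ∃ T ∈ timeInterval β, (∀ t ∈ timeInterval β, T ≤ t → x t ∈ Γ) ∨
      ∀ t ∈ timeInterval β, T ≤ t → x t ∉ Γ := by
  have hpos := hx.pos
  induction β using EReal.rec with
  | bot => simp at hpos
  | top =>
    have hmem : ∀ t : ℝ, 0 ≤ t → t ∈ timeInterval ⊤ := fun t ht => ⟨ht, EReal.coe_lt_top t⟩
    have hlim' : Tendsto x atTop (𝓝 0) := by
      refine hlim.mono_left (tendsto_iff_comap.1 ?_)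
      exact tendsto_nhdsWithin_iff.2 ⟨EReal.tendsto_coe_nhds_top_iff.2 tendsto_id,
        Eventually.of_forall fun t => EReal.coe_lt_top t⟩
    have hd : ∀ᶠ t in atTop, HasDerivAt x (gradient f (x t)) t := by
      filter_upwards [eventually_gt_atTop 0] with t ht
      exact hx.hasDerivAt (hmem t ht.le) ht
    have := hΓ.eventually_mem_or_notMem h0V hlim' fun g hg =>
      eventually_eq_zero_or_ne_zero_of_gradient (hf 0 h0U) hg hd hlim'
    rcases this with h | h
    · obtain ⟨T, hT⟩ := eventually_atTop.1 h
      exact ⟨max T 0, hmem _ (le_max_right _ _),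
        Or.inl fun t _ ht => hT t ((le_max_left _ _).trans ht)⟩
    · obtain ⟨T, hT⟩ := eventually_atTop.1 h
      exact ⟨max T 0, hmem _ (le_max_right _ _),
        Or.inr fun t _ ht => hT t ((le_max_left _ _).trans ht)⟩
  | coe b =>
    have hb : 0 < b := by exact_mod_cast hpos
    have hmem : ∀ t : ℝ, t ∈ timeInterval (b : EReal) ↔ 0 ≤ t ∧ t < b := fun t => by
      simp [timeInterval]
    have hlim' : Tendsto x (𝓝[<] b) (𝓝 0) := by
      refine hlim.mono_left (tendsto_iff_comap.1 ?_)
      refine tendsto_nhdsWithin_iff.2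
        ⟨(continuous_coe_real_ereal.tendsto b).mono_left nhdsWithin_le_nhds, ?_⟩
      filter_upwards [self_mem_nhdsWithin] with t ht
      exact EReal.coe_lt_coe_iff.2 ht
    obtain ⟨y, hy, hy0, hyx⟩ := exists_analyticAt_extension (hf 0 h0U).gradient (x := x) (b := b)
      (by
        filter_upwards [Ioo_mem_nhdsLT hb] with t ht
        exact hx.hasDerivAt ((hmem t).2 ⟨ht.1.le, ht.2⟩) ht.1) hlim'
    have hT : ∀ P : EuclideanSpace ℝ (Fin 2) → Prop, (∀ᶠ t in 𝓝[<] b, P (y t)) →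
        ∃ T ∈ timeInterval (b : EReal), ∀ t ∈ timeInterval (b : EReal), T ≤ t → P (x t) := by
      intro P hP
      obtain ⟨a, hab, ha⟩ := mem_nhdsLT_iff_exists_Ioo_subset.1 hP
      have hab' : max a 0 < b := max_lt hab hb
      refine ⟨(max a 0 + b) / 2, (hmem _).2 ⟨by positivity, by linarith⟩, fun t ht hTt => ?_⟩
      have htb := ((hmem t).1 ht).2
      rw [← hyx t htb]
      exact ha ⟨by linarith [le_max_left a 0], htb⟩
    rcases hΓ.eventually_mem_or_notMem_of_analyticAt hy (by rwa [hy0]) with h | h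
    · obtain ⟨T, hT1, hT2⟩ := hT (· ∈ Γ) (h.filter_mono nhdsWithin_le_nhds)
      exact ⟨T, hT1, Or.inl hT2⟩
    · obtain ⟨T, hT1, hT2⟩ := hT (· ∉ Γ)
        (h.filter_mono (nhdsWithin_mono _ fun t (ht : t < b) => ht.ne))
      exact ⟨T, hT1, Or.inr hT2⟩

end Main

theorem proposition2p1
    (U : Set (EuclideanSpace ℝ (Fin 2))) (hU : IsOpen U) (h0U : 0 ∈ U)
    (f : EuclideanSpace ℝ (Fin 2) → ℝ) (hf : AnalyticOnNhd ℝ f U)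
    (V : Set (EuclideanSpace ℝ (Fin 2))) (hV : IsOpen V) (h0V : 0 ∈ V)
    (Γ : Set (EuclideanSpace ℝ (Fin 2))) (hΓ : IsAnalyticSubset V Γ)
    (β : EReal) (x : ℝ → EuclideanSpace ℝ (Fin 2)) (hx : IsGradientTrajectory U f β x)
    (hlim : Tendsto x (comap (fun t : ℝ => (t : EReal)) (𝓝[<] β)) (𝓝 0))
    (t₀ : ℝ) (ht₀ : t₀ ∈ timeInterval β) (hxV : ∀ t ∈ timeInterval β, t₀ ≤ t → x t ∈ V) :
    (∀ t ∈ timeInterval β, t₀ ≤ t → x t ∈ Γ) ∨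
      {t : ℝ | t ∈ timeInterval β ∧ t₀ ≤ t ∧ x t ∈ Γ}.Finite := by
  set J : Set ℝ := {t | t ∈ timeInterval β ∧ t₀ ≤ t} with hJ
  have hJconn : IsPreconnected J :=
    ((ordConnected_timeInterval β).inter Set.ordConnected_Ici).isPreconnected
  have hlocal : ∀ t ∈ J, (∀ᶠ s in 𝓝 t, s ∈ J → x s ∈ Γ) ∨ ∀ᶠ s in 𝓝[≠] t, s ∈ J → x s ∉ Γ := by
    intro t ht
    obtain ⟨y, hy, hyt, hyx⟩ := hx.exists_analyticAt hf ht.1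
    refine (hΓ.eventually_mem_or_notMem_of_analyticAt hy
      (by rw [hyt]; exact hxV t ht.1 ht.2)).imp (fun h => ?_) (fun h => ?_)
    · filter_upwards [h, hyx] with s h1 h2 hs
      rwa [← h2 hs.1]
    · filter_upwards [h, hyx.filter_mono nhdsWithin_le_nhds] with s h1 h2 hs
      rwa [← h2 hs.1]
  -- Points of `J` may be lacking on the left of `t₀`, never on the right; this makes the two local
  -- alternatives exclusive.
  have hright : ∀ t ∈ J, ∀ᶠ s in 𝓝[>] t, s ∈ J := by
    intro t ht
    obtain ⟨b, htb, hb⟩ := exists_real_gt_of_mem_timeInterval ht.1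
    filter_upwards [Ioo_mem_nhdsGT htb] with s hs
    exact ⟨⟨ht.1.1.trans hs.1.le, (EReal.coe_lt_coe_iff.2 hs.2).trans hb⟩, ht.2.trans hs.1.le⟩
  have hdisj : ∀ t ∈ J, (∀ᶠ s in 𝓝 t, s ∈ J → x s ∈ Γ) →
      ¬ ∀ᶠ s in 𝓝[≠] t, s ∈ J → x s ∉ Γ := by
    intro t ht h1 h2
    obtain ⟨s, hs1, hs2, hs3⟩ := ((hright t ht).and ((h1.filter_mono nhdsWithin_le_nhds).and
      (h2.filter_mono (nhdsWithin_mono t fun s (hs : t < s) => hs.ne')))).exists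
    exact hs3 hs1 (hs2 hs1)
  by_cases hall : ∀ t ∈ J, ∀ᶠ s in 𝓝 t, s ∈ J → x s ∈ Γ
  · exact Or.inl fun t ht ht' => (hall t ⟨ht, ht'⟩).self_of_nhds ⟨ht, ht'⟩
  right
  have hiso : ∀ t ∈ J, ∀ᶠ s in 𝓝[≠] t, s ∈ J → x s ∉ Γ := by
    by_contra hiso
    push Not at hall
    rw [not_forall] at hiso
    simp only [Classical.not_imp] at hiso
    obtain ⟨t₁, ht₁, h1⟩ := hall
    obtain ⟨t₂, ht₂, h2⟩ := hiso
    obtain ⟨t, ht, ht3, ht4⟩ := hJconn {t | ∀ᶠ s in 𝓝 t, s ∈ J → x s ∈ Γ}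
      {t | ∀ᶠ s in 𝓝[≠] t, s ∈ J → x s ∉ Γ} isOpen_setOfPred_eventually_nhds
      isOpen_setOfPred_eventually_nhdsWithin hlocal
      ⟨t₂, ht₂, (hlocal t₂ ht₂).resolve_right h2⟩
      ⟨t₁, ht₁, (hlocal t₁ ht₁).resolve_left fun h => by
        obtain ⟨s, hs1, hs2⟩ := (h1.and_eventually h).exists
        exact hs1.2 (hs2 hs1.1)⟩
    exact hdisj t ht ht3 ht4
  obtain ⟨T, hT, hend⟩ := hx.exists_forall_mem_or_forall_notMem h0U hf h0V hΓ hlim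
  have hTJ : max T t₀ ∈ J := by
    refine ⟨?_, le_max_right _ _⟩
    rcases max_choice T t₀ with h | h <;> rw [h]
    exacts [hT, ht₀]
  -- Staying in `Γ` from `T` on would contradict isolation at the time `max T t₀`.
  have hout : ∀ t ∈ timeInterval β, T ≤ t → x t ∉ Γ := by
    refine hend.resolve_left fun h => ?_
    obtain ⟨s, hs1, hs2, hs3⟩ := ((hright _ hTJ).and (((hiso _ hTJ).filter_mono
      (nhdsWithin_mono _ fun s (hs : max T t₀ < s) => hs.ne')).and self_mem_nhdsWithin)).exists
    exact hs2 hs1 (h s hs1.1 ((le_max_left _ _).trans (le_of_lt hs3)))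
  by_contra hinf
  have hsub : {t : ℝ | t ∈ timeInterval β ∧ t₀ ≤ t ∧ x t ∈ Γ} ⊆ Set.Icc t₀ T := by
    rintro t ⟨h1, h2, h3⟩
    refine ⟨h2, ?_⟩
    by_contra! h
    exact hout t h1 h.le h3
  -- Infinitely many meeting times in the compact `[t₀, T]` accumulate at a time in `J`, against
  -- `hiso`.
  obtain ⟨t, ht, hacc⟩ := Set.Infinite.exists_accPt_of_subset_isCompact hinf isCompact_Icc hsub
  have htJ : t ∈ J := ⟨(ordConnected_timeInterval β).out ht₀ hT ht, ht.1⟩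
  rw [accPt_iff_frequently_nhdsNE] at hacc
  obtain ⟨s, hs1, hs2⟩ := (hacc.and_eventually (hiso t htJ)).exists
  exact hs2 ⟨hs1.1, hs1.2.1⟩ hs1.2.2
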